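/- **Setting.** There are $N\ge 1$ agents, the vertices of a connected undirected graph $G$, a common set of $K\ge 2$ actions with feature vectors $a_1,\dots,a_K$ spanning $\mathbb R^d$ ($d\ge 1$), and a horizon $T\ge 3$. An oblivious adversary fixes $\theta_t(i)\in\mathbb R^d$ such that the losses $\ell_t(i,k)=\langle\theta_t(i),a_k\rangle$ lie in $[-1,1]$; let $\overline\ell_t(k)=\frac1N\sum_{j=1}^N\ell_t(j,k)$. In every round $t$ each agent $i$ draws $A_t(i)$ from its current distribution, independently of the other agents given the past, and observes only $\ell_t(i,A_t(i))$. The regret is $$\mathrm{Reg}_T=\max_{i}\Big(\mathbb E\Big[\sum_{t=1}^T\overline\ell_t(A_t(i))\Big]-\min_{k}\sum_{t=1}^T\overline\ell_t(k)\Big).$$ Let $W$ be a gossip matrix on $G$: symmetric, doubly stochastic, with $W(i,j)>0$ only if $i=j$ or $ij$ is an edge; let $\sigma_2=\sigma_2(W)<1$ be its second largest singular value ($\sigma_2=0$ if $N=1$), and $\rho=1-\sigma_2$. Let $\mathcal S=\{b_1,\dots,b_{|\mathcal S|}\}\subseteq\{a_1,\dots,a_K\}$ be a volumetric spanner with $|\mathcal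 S|\le 3d$: $a_k=\sum_j\lambda^{(k)}(j)\,b_j$ with $\|\lambda^{(k)}\|_2\le1$ for every $k$. Put $$B=\Big\lceil\tfrac{\ln((KT)^6\sqrt{14N})}{(1-1/\sqrt2)\sqrt{1-\sigma_2}}\Big\rceil,\quad \kappa=\tfrac1{1+\sqrt{1-\sigma_2^2}},\quad \eta=\min\Big\{\tfrac1{6Bd},\sqrt{\tfrac{\log K}{dTB+dT/N}}\Big\},\quad \alpha=\tfrac1T,\quad \beta=3Bd\eta.$$ **Algorithm.** The rounds are divided into consecutive blocks $\mathcal T_1,\mathcal T_2,\dots$ of length $B$ (the last one may be shorter). Each agent $i$ keeps two copies of a base learner, one for the odd and one for the even blocks. In block $\tau$ it takes the output $p'_\tau(i)$ of the copy with the parity of $\tau$ and plays in all rounds of the block from $$p_\tau(i)=(1-\alpha-\beta)\,p'_\tau(i)+\tfrac{\alpha}{K}\mathbf 1+\tfrac{\beta}{|\mathcal S|}\mathbf 1_{\mathcal S}.$$ With $M_\tau(i)=\sum_k p_\tau(i,k)\,a_ka_k^\top$ it forms $\widehat\theta_t(i)=M_\tau(i)^{-1}a_{A_t(i)}\,\ell_t(i,A_t(i))$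 and the vector $\widehat\ell_t(i)\in\mathbb R^{|\mathcal S|}$ with entries $\langle b_k,\widehat\theta_t(i)\rangle$. During block $\tau$ the agents perform, one step per round, the accelerated gossip $$z_\tau^{b+1}(i)=(1+\kappa)\sum_{j}W(i,j)\,z_\tau^b(j)-\kappa\, z_\tau^{b-1}(i),$$ the sum being over $i$ and its neighbours, from $z_\tau^{-1}(i)=z_\tau^0(i)=\sum_{t\in\mathcal T_{\tau-1}}\widehat\ell_t(i)$ (zero for $\tau=1$). At the end of block $\tau\ge2$, $z_\tau^B(i)$ is fed to the copy in charge of block $\tau-1$. The base learner outputs the uniform distribution at first; having received $z_1,\dots,z_n$ it reconstructs $\widetilde z_s(k)=\sum_j\lambda^{(k)}(j)z_s(j)$ and outputs the minimizer of $\sum_{s\le n}\langle\widetilde z_s,q\rangle+\frac1\eta\sum_kq(k)\log q(k)$ over the probability simplex. **Theorem.** There are absolute constants $C,C'>0$ and $r\in\mathbb N$ such that in every such setting, if all agents run the algorithm, $$\mathrm{Reg}_T\le C\Big(\sqrt{(\log K)\big(B+\tfrac1N\big)dT}+dB\log K\Big)$$ and $$\mathrm{Reg}_T\le C'\big(\log(KNT)\big)^{r}\Big(\sqrt{\big(\rho^{-1/2}+\tfrac1N\big)dT}+d\rho^{-1/2}\Big).$$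 Moreover, in every round each agent sends to its neighbours one vector of $|\mathcal S|\le 3d$ real numbers. -/

import Mathlib

open scoped BigOperators

noncomputable section

namespace DistLinBandit

/-- The data of a distributed adversarial linear bandit problem with `N` agents, `K` actions in
`ℝ^d` and horizon `T`, together with the objects that the agents share: the gossip matrix and a
spanner with its coefficients.  Rounds are numbered `0, …, T - 1`.
The conditions on these data are collected in `Setting.Admissible`. -/
structure Setting (N K d T : ℕ) where
  /-- the communication graph -/
  G : SimpleGraph (Fin N)
  /-- the gossip matrix -/
  W : Matrix (Fin N) (Fin N) ℝ
  /-- the feature vector of each action -/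
  a : Fin K → Fin d → ℝ
  /-- the (indices of the) actions that form the volumetric spanner -/
  S : Finset (Fin K)
  /-- `lam k` is the vector of coefficients of `a k` in the spanner -/
  lam : Fin K → S → ℝ
  /-- the loss coefficients of agent `i` in round `t`, fixed in advance by an oblivious adversary -/
  theta : Fin T → Fin N → Fin d → ℝ

/-- `W` is a gossip matrix on `G`: symmetric, doubly stochastic and supported on `G`. -/
structure IsGossipMatrix {N : ℕ} (G : SimpleGraph (Fin N)) (W : Matrix (Fin N) (Fin N) ℝ) :
    Prop where
  symm : W.IsSymm
  stochastic : W ∈ doublyStochastic ℝ (Fin N)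
  support : ∀ i j, 0 < W i j → G.Adj i j ∨ i = j

/-- The vectors `b j = a j`, `j ∈ S`, form a volumetric spanner of `{a 0, …, a (K - 1)}`, and
`lam` is a choice of the coefficient vectors: `a k = ∑ j, lam k j • b j` with `‖lam k‖₂ ≤ 1`. -/
def IsVolumetricSpanner {K d : ℕ} (a : Fin K → Fin d → ℝ) (S : Finset (Fin K))
    (lam : Fin K → S → ℝ) : Prop :=
  ∀ k, a k = ∑ j : S, lam k j • a j ∧ √(∑ j : S, lam k j ^ 2) ≤ 1

/-- The second largest singular value of a matrix (Mathlib numbers singular values from `0` in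
decreasing order; for a `1 × 1` matrix the value is `0`). -/
def sigma2 {N : ℕ} (W : Matrix (Fin N) (Fin N) ℝ) : ℝ :=
  (Matrix.toEuclideanLin W).singularValues 1

/-! ### The base learner: follow the regularized leader with entropy -/

/-- `ψ(q) = (1/η) ∑ k, q k log (q k)`. -/
def entropyReg {K : ℕ} (η : ℝ) (q : Fin K → ℝ) : ℝ :=
  1 / η * ∑ k, q k * Real.log (q k)

/-- The minimizer over the simplex of `q ↦ ⟨L, q⟩ + ψ(q)`. -/
def ftrlArgmin {K : ℕ} (η : ℝ) (L : Fin K → ℝ) : Fin K → ℝ :=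
  Classical.epsilon fun q => q ∈ stdSimplex ℝ (Fin K) ∧
    IsMinOn (fun q : Fin K → ℝ => L ⬝ᵥ q + entropyReg η q) (stdSimplex ℝ (Fin K)) q

/-- The minimum is attained, so `ftrlArgmin` is a minimizer. -/
theorem ftrlArgmin_spec {K : ℕ} (hK : 0 < K) (η : ℝ) (L : Fin K → ℝ) :
    ftrlArgmin η L ∈ stdSimplex ℝ (Fin K) ∧
      IsMinOn (fun q : Fin K → ℝ => L ⬝ᵥ q + entropyReg η q) (stdSimplex ℝ (Fin K))
        (ftrlArgmin η L) := by
  apply Classical.epsilon_spec (p := fun q => q ∈ stdSimplex ℝ (Fin K) ∧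
    IsMinOn (fun q : Fin K → ℝ => L ⬝ᵥ q + entropyReg η q) (stdSimplex ℝ (Fin K)) q)
  have : Nonempty (Fin K) := ⟨⟨0, hK⟩⟩
  refine (isCompact_stdSimplex ℝ (Fin K)).exists_isMinOn
    ⟨Pi.single ⟨0, hK⟩ 1, single_mem_stdSimplex ℝ _⟩ (Continuous.continuousOn ?_)
  unfold entropyReg dotProduct
  refine Continuous.add (by fun_prop) (continuous_const.mul (continuous_finsetSum _ fun k _ => ?_))
  exact Real.continuous_mul_log.comp (continuous_apply k)

namespace Setting

variable {N K d T : ℕ}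

/-- The standing assumptions. -/
structure Admissible (P : Setting N K d T) : Prop where
  /-- the communication graph is connected -/
  connected : P.G.Connected
  /-- `W` is a gossip matrix supported on the graph -/
  gossip : IsGossipMatrix P.G P.W
  /-- the spectral gap is positive -/
  sigma2_lt_one : sigma2 P.W < 1
  /-- the actions span `ℝ^d`, that is, the correlation matrices used below are invertible -/
  span : Submodule.span ℝ (Set.range P.a) = ⊤
  /-- the spanner property -/
  spanner : IsVolumetricSpanner P.a P.S P.lam
  /-- the spanner has size at most `3d` -/
  card_le : P.S.card ≤ 3 * d
  /-- all losses lie in `[-1, 1]` -/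
  loss_mem : ∀ t i k, P.theta t i ⬝ᵥ P.a k ∈ Set.Icc (-1 : ℝ) 1

/-! ### Parameters -/

/-- The spectral gap `ρ = 1 - σ₂(W)`. -/
def gap (P : Setting N K d T) : ℝ := 1 - sigma2 P.W

/-- The block length `B = ⌈ln((KT)^6 √(14N)) / ((1 - 1/√2) √(1 - σ₂(W)))⌉`. -/
def blockLen (P : Setting N K d T) : ℕ :=
  ⌈Real.log (((K : ℝ) * T) ^ 6 * √(14 * N)) / ((1 - 1 / √2) * √(1 - sigma2 P.W))⌉₊

/-- The mixing coefficient `κ = 1 / (1 + √(1 - σ₂(W)²))`. -/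
def kappa (P : Setting N K d T) : ℝ := 1 / (1 + √(1 - sigma2 P.W ^ 2))

/-- The learning rate `η = min {1/(6Bd), √(log K / (dTB + dT/N))}`. -/
def eta (P : Setting N K d T) : ℝ :=
  min (1 / (6 * P.blockLen * d)) (√(Real.log K / (d * T * P.blockLen + d * T / N)))

/-- The weight `α = 1/T` of the uniform exploration. -/
def alpha (_P : Setting N K d T) : ℝ := 1 / T

/-- The weight `β = 3Bdη` of the spanner exploration. -/
def beta (P : Setting N K d T) : ℝ := 3 * P.blockLen * d * P.eta

/-- The local loss `ℓ_t(i, k) = ⟨θ_t(i), a_k⟩`. -/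
def loss (P : Setting N K d T) (t : Fin T) (i : Fin N) (k : Fin K) : ℝ := P.theta t i ⬝ᵥ P.a k

/-- The global average loss of action `k` in round `t`. -/
def avgLoss (P : Setting N K d T) (t : Fin T) (k : Fin K) : ℝ := 1 / N * ∑ j, P.loss t j k

/-! ### Gossip -/

open Classical in
/-- The neighbours of agent `i`, including `i`. -/
def nbhd (P : Setting N K d T) (i : Fin N) : Finset (Fin N) :=
  Finset.univ.filter fun j => P.G.Adj i j ∨ j = i

/-- `b` rounds of accelerated gossip on spanner-indexed vectors, started from
`z^{-1} = z^0 = x`: `z^{b+1}(i) = (1+κ) ∑_{j ∈ N(i)} W(i,j) z^b(j) - κ z^{b-1}(i)`. -/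
def gossip (P : Setting N K d T) (x : Fin N → P.S → ℝ) : ℕ → Fin N → P.S → ℝ
  | 0 => x
  | 1 => fun i => (1 + P.kappa) • (∑ j ∈ P.nbhd i, P.W i j • x j) - P.kappa • x i
  | b + 2 => fun i => (1 + P.kappa) • (∑ j ∈ P.nbhd i, P.W i j • gossip P x (b + 1) j)
      - P.kappa • gossip P x b i

/-! ### Loss estimates -/

/-- The correlation matrix `∑ j, p j • a_j a_jᵀ` of a sampling distribution. -/
def corrMatrix (P : Setting N K d T) (p : Fin K → ℝ) : Matrix (Fin d) (Fin d) ℝ :=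
  ∑ j, p j • Matrix.vecMulVec (P.a j) (P.a j)

/-- The estimate `θ̂_t(i) = M⁻¹ a_k ℓ_t(i, k)` after agent `i`, who samples from `p`, has
played `k` and has observed the number `ℓ_t(i, k)`. -/
def thetaEst (P : Setting N K d T) (p : Fin K → ℝ) (t : Fin T) (i : Fin N) (k : Fin K) :
    Fin d → ℝ :=
  (P.corrMatrix p)⁻¹.mulVec (P.loss t i k • P.a k)

/-- The estimated losses `⟨b_s, θ̂_t(i)⟩` of the spanner vectors. -/
def lossEst (P : Setting N K d T) (p : Fin K → ℝ) (t : Fin T) (i : Fin N) (k : Fin K) :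
    P.S → ℝ :=
  fun s => P.a s ⬝ᵥ P.thetaEst p t i k

/-! ### The algorithm -/

/-- `z̃(k) = ∑ j, λ^{(k)}(j) z(j)`: losses of all actions reconstructed from the spanner. -/
def reconstruct (P : Setting N K d T) (z : P.S → ℝ) : Fin K → ℝ :=
  fun k => ∑ j : P.S, P.lam k j * z j

/-- The output of the base learner after it has received the listed feedback vectors: uniform in
the beginning, then the entropy-regularized leader for the reconstructed losses. -/
def baseOutput (P : Setting N K d T) (zs : List (P.S → ℝ)) : Fin K → ℝ :=
  if zs = [] then fun _ => 1 / K else ftrlArgmin P.eta (zs.map P.reconstruct).sum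

/-- What the network carries from one block to the next. -/
structure NetState (P : Setting N K d T) where
  /-- for each agent, the feedback received so far by each of its two base learners -/
  feedback : Fin N → Fin 2 → List (P.S → ℝ)
  /-- the vectors at which the gossip of the coming block starts -/
  start : Fin N → P.S → ℝ

/-- The sampling distribution of agent `i` in block `n`:
`p = (1 - α - β) p' + (α/K) 𝟏 + (β/|S|) 𝟏_S`, where `p'` is the output of the base learner
in charge of the blocks with the parity of `n`. -/
def blockPolicy (P : Setting N K d T) (n : ℕ) (st : P.NetState) (i : Fin N) : Fin K → ℝ :=
  fun k => (1 - P.alpha - P.beta) * P.baseOutput (st.feedback i (Fin.ofNat 2 n)) k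
    + P.alpha / K + P.beta / P.S.card * (if k ∈ P.S then 1 else 0)

/-- Block `n = 0, 1, …`, which consists of the rounds `t` with `t / B = n`, when the agents play
the actions `A`.  The estimates of the previous block are gossiped `B` times, and the result is
sent to the base learner that was in charge of the previous block; the estimates of this
block are summed up and become the starting vectors of the next gossip. -/
def blockStep (P : Setting N K d T) (A : Fin T → Fin N → Fin K) (n : ℕ) (st : P.NetState) :
    P.NetState where
  feedback i := if n = 0 then st.feedback i else
    Function.update (st.feedback i) (Fin.ofNat 2 (n - 1))
      (st.feedback i (Fin.ofNat 2 (n - 1)) ++ [P.gossip st.start P.blockLen i])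
  start i := ∑ t ∈ Finset.univ.filter (fun t : Fin T => (t : ℕ) / P.blockLen = n),
    P.lossEst (P.blockPolicy n st i) t i (A t i)

/-- The state of the network at the beginning of block `n` when the agents play `A`. -/
def netState (P : Setting N K d T) (A : Fin T → Fin N → Fin K) : ℕ → P.NetState
  | 0 => ⟨fun _ _ => [], 0⟩
  | n + 1 => P.blockStep A n (netState P A n)

/-- The distribution from which agent `i` samples in block `n`.  It depends on `A` only through
the rounds of the blocks before `n`, see `policy_congr`. -/
def policy (P : Setting N K d T) (A : Fin T → Fin N → Fin K) (n : ℕ) (i : Fin N) : Fin K → ℝ :=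
  P.blockPolicy n (P.netState A n) i

/-! ### Expectation and regret -/

/-- The probability that the agents play `A`: in each round, given the past, the agents sample
independently of each other from their current distributions. -/
def prob (P : Setting N K d T) (A : Fin T → Fin N → Fin K) : ℝ :=
  ∏ t : Fin T, ∏ i, P.policy A ((t : ℕ) / P.blockLen) i (A t i)

/-- Expectation with respect to the internal randomization of the agents. -/
def expect (P : Setting N K d T) (f : (Fin T → Fin N → Fin K) → ℝ) : ℝ :=
  ∑ A, P.prob A * f A

/-- The regret of agent `i`. -/
def regret (P : Setting N K d T) (i : Fin N) : ℝ :=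
  P.expect (fun A => ∑ t, P.avgLoss t (A t i)) - ⨅ k, P.expect (fun _ => ∑ t, P.avgLoss t k)

/-- The regret `max_i Reg_T(i)`. -/
def maxRegret (P : Setting N K d T) : ℝ := ⨆ i, P.regret i

/-! ### Communication -/

/-- The numbers that agent `i` sends to all its neighbours in round `t`: the
coordinates of its current gossip vector.  By the definition of `gossip` this is all that the
neighbours ever learn from agent `i` in that round. -/
def message (P : Setting N K d T) (A : Fin T → Fin N → Fin K) (t : Fin T) (i : Fin N) : List ℝ :=
  (Finset.univ : Finset P.S).toList.map
    (P.gossip (P.netState A ((t : ℕ) / P.blockLen)).start ((t : ℕ) % P.blockLen) i)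

/-- The number of real numbers in the message of agent `i` in round `t`. -/
def commCost (P : Setting N K d T) (A : Fin T → Fin N → Fin K) (t : Fin T) (i : Fin N) : ℕ :=
  (P.message A t i).length

/-! ### The weights `prob` are a probability distribution on the trajectories -/

theorem netState_congr (P : Setting N K d T) {A A' : Fin T → Fin N → Fin K} (n : ℕ)
    (h : ∀ t : Fin T, (t : ℕ) / P.blockLen < n → A t = A' t) :
    P.netState A n = P.netState A' n := by
  induction n with
  | zero => rfl
  | succ n ih =>
    have e := ih fun t ht => h t (by omega)
    simp only [netState, blockStep, e]
    congr 1
    funext i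
    refine Finset.sum_congr rfl fun t ht => ?_
    rw [h t (by have := (Finset.mem_filter.1 ht).2; omega)]

theorem policy_congr (P : Setting N K d T) {A A' : Fin T → Fin N → Fin K} (n : ℕ)
    (h : ∀ t : Fin T, (t : ℕ) / P.blockLen < n → A t = A' t) :
    P.policy A n = P.policy A' n := by
  funext i
  rw [policy, policy, P.netState_congr n h]

theorem alpha_add_beta_le (P : Setting N K d T) (hT : 3 ≤ T) : P.alpha + P.beta ≤ 1 := by
  have h1 : P.alpha ≤ 1 / 3 := by
    unfold alpha
    exact one_div_le_one_div_of_le (by norm_num) (by exact_mod_cast hT)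
  have h2 : P.beta ≤ 1 / 2 := by
    have h3 : P.eta ≤ 1 / (6 * P.blockLen * d) := min_le_left _ _
    have h4 : (0 : ℝ) ≤ P.blockLen * d := by positivity
    unfold beta
    rcases h4.eq_or_lt with h5 | h5
    · rw [mul_assoc 3, ← h5]; norm_num
    · calc 3 * (P.blockLen : ℝ) * d * P.eta = 3 * (P.blockLen * d) * P.eta := by ring
        _ ≤ 3 * (P.blockLen * d) * (1 / (6 * P.blockLen * d)) := by gcongr
        _ = 1 / 2 := by rw [mul_assoc 6]; generalize (P.blockLen : ℝ) * d = x at h5; field_simp; norm_num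
  linarith

theorem eta_nonneg (P : Setting N K d T) : 0 ≤ P.eta :=
  le_min (by positivity) (Real.sqrt_nonneg _)

theorem baseOutput_mem (P : Setting N K d T) (hK : 0 < K) (zs : List (P.S → ℝ)) :
    P.baseOutput zs ∈ stdSimplex ℝ (Fin K) := by
  unfold baseOutput
  split
  · refine ⟨fun _ => by positivity, ?_⟩
    have : (K : ℝ) ≠ 0 := by positivity
    simp [this]
  · exact (ftrlArgmin_spec hK _ _).1

theorem Admissible.card_pos {P : Setting N K d T} (hP : P.Admissible) (hd : 0 < d) :
    0 < P.S.card := by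
  by_contra h0
  have hS : P.S = ∅ := by simpa using h0
  have ha : ∀ k, P.a k = 0 := by
    intro k
    have : IsEmpty P.S := by rw [hS]; infer_instance
    rw [(hP.spanner k).1]
    simp
  have hs := hP.span
  have : Submodule.span ℝ (Set.range P.a) = ⊥ := by
    rw [Submodule.span_eq_bot]
    rintro _ ⟨k, rfl⟩
    exact ha k
  rw [this] at hs
  have hx : (Pi.single ⟨0, hd⟩ 1 : Fin d → ℝ) ∈ (⊥ : Submodule ℝ (Fin d → ℝ)) := by
    rw [hs]; trivial
  have := congrFun ((Submodule.mem_bot ℝ).1 hx) ⟨0, hd⟩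
  simp at this

theorem policy_mem {P : Setting N K d T} (hP : P.Admissible) (hd : 0 < d) (hK : 0 < K)
    (hT : 3 ≤ T) (A : Fin T → Fin N → Fin K) (n : ℕ) (i : Fin N) :
    P.policy A n i ∈ stdSimplex ℝ (Fin K) := by
  obtain ⟨h1, h2⟩ := P.baseOutput_mem hK ((P.netState A n).feedback i (Fin.ofNat 2 n))
  have hab := P.alpha_add_beta_le hT
  have hα : 0 ≤ P.alpha := by unfold alpha; positivity
  have hβ : 0 ≤ P.beta := mul_nonneg (by positivity) P.eta_nonneg
  have hc : (P.S.card : ℝ) ≠ 0 := by exact_mod_cast (hP.card_pos hd).ne'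
  have hK' : (K : ℝ) ≠ 0 := by positivity
  constructor
  · intro k
    have h3 := mul_nonneg (show 0 ≤ 1 - P.alpha - P.beta by linarith) (h1 k)
    have h4 : 0 ≤ P.beta / P.S.card * (if k ∈ P.S then 1 else 0) := by
      split <;> positivity
    have h5 : 0 ≤ P.alpha / K := by positivity
    unfold policy blockPolicy
    linarith
  · simp only [policy, blockPolicy, Finset.sum_add_distrib, ← Finset.mul_sum, h2]
    simp
    field_simp
    ring

theorem sum_prod_eq_one {X : Type*} [Fintype X] [Nonempty X] (T : ℕ)
    (g : Fin T → (Fin T → X) → X → ℝ)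
    (hg : ∀ t A A', (∀ s, s < t → A s = A' s) → g t A = g t A')
    (h1 : ∀ t A, ∑ x, g t A x = 1) : ∑ A : Fin T → X, ∏ t, g t A (A t) = 1 := by
  induction T with
  | zero => simp
  | succ T ih =>
    obtain ⟨x₀⟩ := ‹Nonempty X›
    have key : ∀ (A : Fin T → X) (x : X), ∏ t, g t (Fin.snoc A x : Fin (T + 1) → X)
        ((Fin.snoc A x : Fin (T + 1) → X) t) =
        (∏ t : Fin T, g t.castSucc (Fin.snoc A x₀ : Fin (T + 1) → X) (A t)) *
          g (Fin.last T) (Fin.snoc A x₀ : Fin (T + 1) → X) x := by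
      intro A x
      have hc : ∀ t, g t (Fin.snoc A x : Fin (T + 1) → X) = g t (Fin.snoc A x₀) := by
        intro t
        refine hg t _ _ fun s hs => ?_
        have hs' : s ≠ Fin.last T := (hs.trans_le (Fin.le_last t)).ne
        obtain ⟨s, rfl⟩ := Fin.exists_castSucc_eq.2 hs'
        simp
      rw [Fin.prod_univ_castSucc]
      simp [hc]
    rw [← (Fin.snocEquiv fun _ : Fin (T + 1) => X).sum_comp, Fintype.sum_prod_type,
      Finset.sum_comm]
    change ∑ A : Fin T → X, ∑ x : X, ∏ t, g t (Fin.snoc A x : Fin (T + 1) → X)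
        ((Fin.snoc A x : Fin (T + 1) → X) t) = 1
    simp only [key, ← Finset.mul_sum, h1, mul_one]
    refine ih (fun t A => g t.castSucc (Fin.snoc A x₀ : Fin (T + 1) → X))
      (fun t A A' h => hg _ _ _ fun s hs => ?_) (fun t A => h1 _ _)
    have hs' : s ≠ Fin.last T := (hs.trans_le (Fin.le_last _)).ne
    obtain ⟨s, rfl⟩ := Fin.exists_castSucc_eq.2 hs'
    simpa using h s (by simpa using hs)

theorem prob_nonneg {P : Setting N K d T} (hP : P.Admissible) (hd : 0 < d) (hK : 0 < K)
    (hT : 3 ≤ T) (A : Fin T → Fin N → Fin K) : 0 ≤ P.prob A :=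
  Finset.prod_nonneg fun _ _ => Finset.prod_nonneg fun i _ =>
    (policy_mem hP hd hK hT A _ i).1 _

theorem sum_prob {P : Setting N K d T} (hP : P.Admissible) (hd : 0 < d) (hK : 0 < K)
    (hT : 3 ≤ T) : ∑ A, P.prob A = 1 := by
  have : Nonempty (Fin K) := ⟨⟨0, hK⟩⟩
  refine sum_prod_eq_one T
    (fun t A x => ∏ i, P.policy A ((t : ℕ) / P.blockLen) i (x i)) (fun t A A' h => ?_) ?_
  · funext x
    rw [P.policy_congr _ fun s hs => h s ?_]
    by_contra hts
    exact absurd (Nat.div_le_div_right (c := P.blockLen) (Fin.le_def.1 (not_lt.1 hts)))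
      (not_le.2 hs)
  · intro t A
    rw [← Fintype.piFinset_univ, ← Finset.prod_univ_sum]
    exact Finset.prod_eq_one fun i _ => (policy_mem hP hd hK hT A _ i).2

end Setting

end DistLinBandit

end

/-! After a block of gossip, every agent holds the network average of the block's loss estimates up
to a negligible error. So all agents run almost the same exponential weights algorithm, on unbiased
losses whose variance is reduced by averaging over `N` independent samples. The regret is then that
of one learner with block losses, plus the cost of exploration.

Gossip. On vectors with zero sum `W` is bounded by `σ₂`. Rescaling the iterates by powers of `√κ`
turns accelerated gossip into a Chebyshev recurrence for a contraction, whose solutions grow at most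
linearly because a quadratic energy is conserved. Deviations from the average therefore decay like
`n √κ ^ n`, and `B` makes them negligible (`norm_le_of_gossip_recurrence`, `abs_gossip_sub_le`).
Reconstruction from the spanner is exact because the estimates are linear in the action
(`reconstruct_lossEst`).

Learner. The entropic leader is exponential weights (`ftrlArgmin_eq`). The estimates of a block
arrive only at the end of the next one, in time for the next block of the same parity; hence each of
the two copies sees no delay (`base_eq`, `expWeights_regret_interleaved`). Exploring the spanner
keeps `η` times a block loss at most 2.

Second moment. A block loss is its mean, of size at most `B`, plus errors that are uncorrelated over
the rounds and, given the past, independent over the agents. The trace identity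
`sum_mul_dotProduct_inv_self` bounds the variance of each agent's estimate by `d` when averaged over
that agent's own policy. The weights belong to another agent, which costs a constant since all
policies are comparable (`policy_le_mul_policy`). A block of `m` rounds contributes `O(m (B +
d/N))`.

Altogether the regret is of order `log K / η + η (dTB + dT/N)`, where exploration also contributes
to `dTB`; `η` balances the two terms. If `B ≥ T`, the trivial bound `2T` suffices. The second
estimate follows from `blockLen_le`. -/

open scoped BigOperators

noncomputable section

namespace DistLinBandit

/-! ### Spectral bounds and the rate of accelerated gossip. -/

section Spectral

variable {E : Type*} [NormedAddCommGroup E] [InnerProductSpace ℝ E]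

/-- If `u` is a fixed vector of a symmetric map whose second singular value is less than one,
then this singular value bounds the map on the orthogonal complement of `u`. -/
theorem norm_apply_le_singularValues_one [FiniteDimensional ℝ E] {T : E →ₗ[ℝ] E} (hT : T.IsSymmetric) {u v : E}
    (hu : u ≠ 0) (hTu : T u = u) (h1 : T.singularValues 1 < 1) (hv : inner ℝ u v = 0) :
    ‖T v‖ ≤ T.singularValues 1 * ‖v‖ := by
  set H := T.isSymmetric_adjoint_comp_self
  set b := H.eigenvectorBasis rfl with hb
  set σ := T.singularValues 1 with hσ
  have hσ0 : 0 ≤ σ := T.singularValues_nonneg 1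
  have happ : ∀ i (x : E), inner ℝ (b i) ((LinearMap.adjoint T ∘ₗ T) x) =
      T.singularValues i ^ 2 * inner ℝ (b i) x := by
    intro i x
    rw [← H, hb, H.apply_eigenvectorBasis, T.sq_singularValues_fin rfl, inner_smul_left]
    simp
  have hle : ∀ i : Fin (Module.finrank ℝ E), 1 ≤ (i : ℕ) → T.singularValues i ^ 2 ≤ σ ^ 2 :=
    fun i hi => pow_le_pow_left₀ (T.singularValues_nonneg _) (T.singularValues_antitone hi) 2
  have hTTu : (LinearMap.adjoint T ∘ₗ T) u = u := by
    have : LinearMap.adjoint T = T := hT.adjoint_eq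
    simp [this, hTu]
  -- `u` is an eigenvector of `T*T` for the eigenvalue 1, while all eigenvalues of index at least 1
  -- are smaller; so `u` is a multiple of `b 0`, and `v ⟂ u` has no component along `b 0`.
  have hu0 : ∀ i : Fin (Module.finrank ℝ E), 1 ≤ (i : ℕ) → inner ℝ (b i) u = 0 := by
    intro i hi
    have h2 := happ i u
    rw [hTTu] at h2
    have h3 : σ ^ 2 < 1 := by nlinarith
    have h4 := hle i hi
    have h5 : (1 - T.singularValues i ^ 2) * inner ℝ (b i) u = 0 := by linarith
    rcases mul_eq_zero.1 h5 with h6 | h6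
    · linarith
    · exact h6
  have hsum : ∀ x y : E, ∑ i, inner ℝ (b i) x * inner ℝ (b i) y = inner ℝ x y := by
    intro x y
    rw [← b.sum_inner_mul_inner x y]
    exact Finset.sum_congr rfl fun i _ => by rw [real_inner_comm]
  have hv0 : ∀ i : Fin (Module.finrank ℝ E), (i : ℕ) = 0 → inner ℝ (b i) v = 0 := by
    intro i hi
    have hone : ∀ y : E, inner ℝ (b i) u * inner ℝ (b i) y = inner ℝ u y := by
      intro y
      rw [← hsum u y]
      rw [Finset.sum_eq_single i]
      · intro j _ hj
        have : (j : ℕ) ≠ i := fun h => hj (Fin.ext h)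
        rw [hu0 j (by omega), zero_mul]
      · exact fun h => absurd (Finset.mem_univ _) h
    have h2 := hone v
    rw [hv] at h2
    rcases mul_eq_zero.1 h2 with h3 | h3
    · have := hone u
      rw [h3, zero_mul, eq_comm, inner_self_eq_zero] at this
      exact absurd this hu
    · exact h3
  have hkey : ‖T v‖ ^ 2 ≤ (σ * ‖v‖) ^ 2 := by
    have h2 : ‖T v‖ ^ 2 = inner ℝ v ((LinearMap.adjoint T ∘ₗ T) v) := by
      rw [LinearMap.comp_apply, LinearMap.adjoint_inner_right, real_inner_self_eq_norm_sq]
    rw [h2, ← hsum, mul_pow, ← real_inner_self_eq_norm_sq, ← hsum v v, Finset.mul_sum]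
    refine Finset.sum_le_sum fun i _ => ?_
    rw [happ]
    rcases Nat.eq_zero_or_pos (i : ℕ) with hi | hi
    · rw [hv0 i hi]; simp
    · nlinarith [hle i hi, mul_self_nonneg (inner ℝ (b i) v)]
  exact le_of_sq_le_sq hkey (by positivity)

/-- Linear growth of the solutions of `y (n + 2) = 2 X (y (n + 1)) - y n` for a symmetric `X` that
is a contraction along the solution. -/
theorem norm_le_of_chebyshev_recurrence {X : E →ₗ[ℝ] E} (hX : X.IsSymmetric) {y : ℕ → E} {q : ℝ}
    (hq0 : 0 ≤ q) (hq1 : q ≤ 1) (hc : ∀ n, ‖X (y n)‖ ≤ ‖y n‖)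
    (h1 : y 1 = (2 : ℝ) • X (y 0) - q • y 0)
    (hrec : ∀ n, y (n + 2) = (2 : ℝ) • X (y (n + 1)) - y n) (n : ℕ) :
    ‖y n‖ ≤ (1 + 2 * n) * ‖y 0‖ := by
  -- By symmetry of `X` this energy is independent of `n`; initially it is at most `(1 + q)² ‖y
  -- 0‖²`. As `X` contracts along the solution, it controls the increment `y (n + 1) - X (y n)`.
  have hen : ∀ n, ‖y (n + 1) - X (y n)‖ ^ 2 + ‖y n‖ ^ 2 - ‖X (y n)‖ ^ 2 ≤ 4 * ‖y 0‖ ^ 2 := by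
    intro n
    induction n with
    | zero =>
      have e : y (0 + 1) - X (y 0) = X (y 0) - q • y 0 := by rw [zero_add, h1, two_smul]; abel
      rw [e, norm_sub_sq_real, norm_smul, inner_smul_right, Real.norm_eq_abs, mul_pow, sq_abs]
      have h2 := abs_le.1 ((abs_real_inner_le_norm (X (y 0)) (y 0)).trans
        (mul_le_mul_of_nonneg_right (hc 0) (norm_nonneg _)))
      have h3 := mul_nonneg (sub_nonneg.2 hq1) (sq_nonneg ‖y 0‖)
      have h4 := mul_nonneg hq0 h3
      nlinarith [mul_le_mul_of_nonneg_left h2.1 hq0]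
    | succ n ih =>
      have e : y (n + 1 + 1) - X (y (n + 1)) = X (y (n + 1)) - y n := by
        rw [hrec, two_smul]; abel
      rw [e, norm_sub_sq_real, hX]
      rw [norm_sub_sq_real] at ih
      linarith
  induction n with
  | zero => simp
  | succ n ih =>
    have h2 : ‖y (n + 1) - X (y n)‖ ≤ 2 * ‖y 0‖ := by
      refine le_of_sq_le_sq ?_ (by positivity)
      have := pow_le_pow_left₀ (norm_nonneg _) (hc n) 2
      nlinarith [hen n]
    have h3 : ‖y (n + 1)‖ ≤ ‖y (n + 1) - X (y n)‖ + ‖X (y n)‖ := by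
      simpa using norm_add_le (y (n + 1) - X (y n)) (X (y n))
    push_cast
    linarith [hc n]

end Spectral

/-- Accelerated gossip contracts the vectors on which `W` is bounded by `σ`. -/
theorem norm_le_of_gossip_recurrence {E : Type*} [NormedAddCommGroup E] [InnerProductSpace ℝ E]
    {W : E →ₗ[ℝ] E} (hW : W.IsSymmetric) {σ κ : ℝ} (hσ0 : 0 ≤ σ)
    (hσ1 : σ < 1) (hκ : κ = 1 / (1 + √(1 - σ ^ 2))) {z : ℕ → E}
    (hc : ∀ n, ‖W (z n)‖ ≤ σ * ‖z n‖) (h1 : z 1 = (1 + κ) • W (z 0) - κ • z 0)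
    (hrec : ∀ n, z (n + 2) = (1 + κ) • W (z (n + 1)) - κ • z n) (n : ℕ) :
    ‖z n‖ ≤ (1 + 2 * n) * √κ ^ n * ‖z 0‖ := by
  set s := √(1 - σ ^ 2) with hs
  have hs2 : s ^ 2 = 1 - σ ^ 2 := Real.sq_sqrt (by nlinarith)
  have hs0 : 0 < s := Real.sqrt_pos.2 (by nlinarith)
  have hκ0 : 0 < κ := by rw [hκ]; positivity
  have hκ1 : κ ≤ 1 := by rw [hκ, div_le_one (by positivity)]; linarith
  have hks : κ * (1 + s) = 1 := by rw [hκ]; field_simp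
  set q := √κ with hq
  have hq0 : 0 < q := Real.sqrt_pos.2 hκ0
  have hq2 : q ^ 2 = κ := Real.sq_sqrt hκ0.le
  have hq1 : q ≤ 1 := by nlinarith
  -- This makes the rescaled operator `X` below a contraction. With `κ s = 1 - κ` and denominators
  -- cleared it reads `(1 - κ)² (1 + 2κ) ≥ 0`.
  have hbound : (1 + κ) * σ ≤ 2 * q := by
    refine le_of_sq_le_sq ?_ (by positivity)
    have e : (1 + κ) ^ 2 * (1 - s ^ 2) ≤ 4 * κ := by
      have : κ * s = 1 - κ := by linarith
      have h3 : (1 + κ) ^ 2 * (κ ^ 2 - (κ * s) ^ 2) ≤ 4 * κ * κ ^ 2 := by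
        rw [this]
        nlinarith [mul_nonneg (sub_nonneg.2 hκ1) (sq_nonneg (1 - κ)),
          mul_nonneg hκ0.le (sq_nonneg (1 - κ))]
      have h4 : ((1 + κ) ^ 2 * (1 - s ^ 2)) * κ ^ 2 ≤ (4 * κ) * κ ^ 2 := by
        calc _ = (1 + κ) ^ 2 * (κ ^ 2 - (κ * s) ^ 2) := by ring
          _ ≤ _ := h3
      exact le_of_mul_le_mul_right h4 (by positivity)
    rw [mul_pow, mul_pow, hq2]
    have : σ ^ 2 = 1 - s ^ 2 := by linarith
    rw [this]
    linarith
  set X : E →ₗ[ℝ] E := ((1 + κ) / (2 * q)) • W with hXd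
  have hX : X.IsSymmetric := fun x y => by
    simp [hXd, inner_smul_left, inner_smul_right, hW x y]
  set y : ℕ → E := fun n => (q ^ n)⁻¹ • z n with hy
  have hyz : ∀ n, z n = q ^ n • y n := fun n => by
    simp [hy, smul_smul, hq0.ne']
  have hstep : ∀ n, (q ^ (n + 1))⁻¹ • (1 + κ) • W (z n) = (2 : ℝ) • X (y n) := by
    intro n
    simp only [hXd, hy, LinearMap.smul_apply, map_smul, smul_smul]
    congr 1
    field_simp
    ring
  have key := norm_le_of_chebyshev_recurrence hX (y := y) hq0.le hq1 ?_ ?_ ?_ n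
  · rw [hyz n, norm_smul, Real.norm_of_nonneg (by positivity)]
    have e0 : y 0 = z 0 := by simp [hy]
    rw [e0] at key
    calc q ^ n * ‖y n‖ ≤ q ^ n * ((1 + 2 * n) * ‖z 0‖) := by gcongr
      _ = _ := by ring
  · intro n
    have h2 : ‖W (y n)‖ ≤ σ * ‖y n‖ := by
      simp only [hy, map_smul, norm_smul]
      nlinarith [hc n, norm_nonneg (q ^ n)⁻¹]
    rw [hXd, LinearMap.smul_apply, norm_smul, Real.norm_of_nonneg (by positivity)]
    have h3 : (1 + κ) / (2 * q) * σ ≤ 1 := by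
      rw [div_mul_eq_mul_div, div_le_one (by positivity)]; exact hbound
    calc _ ≤ (1 + κ) / (2 * q) * (σ * ‖y n‖) := by gcongr
      _ = (1 + κ) / (2 * q) * σ * ‖y n‖ := by ring
      _ ≤ 1 * ‖y n‖ := by gcongr
      _ = _ := one_mul _
  · have h2 := hstep 0
    rw [← h2]
    simp only [hy, h1, smul_sub, smul_smul]
    congr 2
    rw [← hq2]; field_simp
  · intro n
    rw [← hstep (n + 1)]
    simp only [hy, hrec, smul_sub, smul_smul]
    congr 2
    rw [← hq2]; field_simp; ring

theorem sigma2_nonneg {N : ℕ} (W : Matrix (Fin N) (Fin N) ℝ) : 0 ≤ sigma2 W :=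
  LinearMap.singularValues_nonneg _ _

/-- The all-ones vector is fixed by a doubly stochastic matrix, and zero sum means orthogonality to
it. -/
theorem norm_toEuclideanLin_le {N : ℕ} [NeZero N] {W : Matrix (Fin N) (Fin N) ℝ} (hs : W.IsSymm)
    (hd : W ∈ doublyStochastic ℝ (Fin N)) (h1 : sigma2 W < 1) (v : EuclideanSpace ℝ (Fin N))
    (hv : ∑ i, v i = 0) : ‖Matrix.toEuclideanLin W v‖ ≤ sigma2 W * ‖v‖ := by
  have hsym : (Matrix.toEuclideanLin W).IsSymmetric := by
    rw [Matrix.isSymmetric_toEuclideanLin_iff]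
    exact hs
  refine norm_apply_le_singularValues_one hsym (u := WithLp.toLp 2 1) ?_ ?_ h1 ?_
  · intro h
    have := congrArg (fun w : EuclideanSpace ℝ (Fin N) => w 0) h
    simp at this
  · ext i
    have := mulVec_one_of_mem_doublyStochastic hd
    simp [Matrix.toLpLin_apply, this]
  · simp [PiLp.inner_apply, hv]

/-- With `u = √(1 - σ)`, the convex function `1/√(1 + u)` lies on `[0, 1]` below its chord `1 - (1 -
1/√2) u`; this is the origin of the constant in the block length. -/
theorem sqrt_kappa_le {σ : ℝ} (hσ0 : 0 ≤ σ) (hσ1 : σ < 1) :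
    √(1 / (1 + √(1 - σ ^ 2))) ≤ Real.exp (-((1 - 1 / √2) * √(1 - σ))) := by
  have hu : √(1 - σ) ≤ √(1 - σ ^ 2) := Real.sqrt_le_sqrt (by nlinarith)
  set u := √(1 - σ)
  have hu0 : 0 ≤ u := Real.sqrt_nonneg _
  have hu1 : u ≤ 1 := Real.sqrt_le_one.2 (by linarith)
  have h2 : √2 ^ 2 = 2 := Real.sq_sqrt (by norm_num)
  have h20 : 0 < √2 := by positivity
  set c := 1 / √2 with hcdef
  have hc2 : c ^ 2 = 1 / 2 := by rw [hcdef, div_pow, h2]; norm_num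
  have hc0 : 0 < c := by positivity
  have hc1 : c ≤ 0.71 := by nlinarith
  have hc3 : 0.7 ≤ c := by nlinarith
  calc √(1 / (1 + √(1 - σ ^ 2))) ≤ √(1 / (1 + u)) := by gcongr
    _ ≤ 1 - (1 - c) * u := by
      refine Real.sqrt_le_iff.2 ⟨by nlinarith, ?_⟩
      rw [div_le_iff₀ (by positivity)]
      nlinarith [mul_nonneg hu0 (sub_nonneg.2 hu1), mul_nonneg (mul_nonneg hu0 (sub_nonneg.2 hu1)) hu0,
       mul_nonneg (mul_nonneg hu0 (sub_nonneg.2 hu1)) hc0.le, mul_nonneg (mul_nonneg (mul_nonneg hu0 (sub_nonneg.2 hu1)) hc0.le) hu0]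
    _ ≤ _ := by linarith [Real.add_one_le_exp (-((1 - c) * u))]

/-! ### Consensus of the gossip iterates. -/

namespace Setting

variable {N K d T : ℕ}

theorem sum_nbhd_smul {P : Setting N K d T} (hP : P.Admissible) (x : Fin N → P.S → ℝ) (i : Fin N) :
    ∑ j ∈ P.nbhd i, P.W i j • x j = ∑ j, P.W i j • x j := by
  refine Finset.sum_subset (Finset.subset_univ _) fun j _ hj => ?_
  have h0 : 0 ≤ P.W i j := nonneg_of_mem_doublyStochastic hP.gossip.stochastic
  have h1 : ¬ 0 < P.W i j := fun h => hj (by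
    rcases hP.gossip.support i j h with h2 | h2
    · simp [nbhd, h2]
    · simp [nbhd, h2])
  rw [le_antisymm (not_lt.1 h1) h0, zero_smul]

/-- The deviation of the gossip iterates from the initial average, one spanner coordinate at a
time. -/
def gossipDev (P : Setting N K d T) (x : Fin N → P.S → ℝ) (s : P.S) (b : ℕ) :
    EuclideanSpace ℝ (Fin N) :=
  WithLp.toLp 2 fun i => P.gossip x b i s - 1 / N * ∑ j, x j s

theorem gossip_one_apply {P : Setting N K d T} (hP : P.Admissible) (x : Fin N → P.S → ℝ)
    (i : Fin N) (s : P.S) : P.gossip x 1 i s =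
      (1 + P.kappa) * (∑ j, P.W i j * P.gossip x 0 j s) - P.kappa * P.gossip x 0 i s := by
  simp [gossip, sum_nbhd_smul hP, Finset.sum_apply]

theorem gossip_add_two_apply {P : Setting N K d T} (hP : P.Admissible) (x : Fin N → P.S → ℝ)
    (b : ℕ) (i : Fin N) (s : P.S) : P.gossip x (b + 2) i s =
      (1 + P.kappa) * (∑ j, P.W i j * P.gossip x (b + 1) j s) - P.kappa * P.gossip x b i s := by
  simp [gossip, sum_nbhd_smul hP, Finset.sum_apply]

theorem Admissible.pos_agents {P : Setting N K d T} (hP : P.Admissible) : 0 < N :=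
  Fin.pos_iff_nonempty.2 hP.connected.nonempty

theorem sum_toEuclideanLin_apply {P : Setting N K d T} (hP : P.Admissible)
    (v : EuclideanSpace ℝ (Fin N)) : ∑ i, Matrix.toEuclideanLin P.W v i = ∑ i, v i := by
  simp only [Matrix.toLpLin_apply, Matrix.mulVec, dotProduct]
  rw [Finset.sum_comm]
  refine Finset.sum_congr rfl fun j _ => ?_
  rw [← Finset.sum_mul, sum_col_of_mem_doublyStochastic hP.gossip.stochastic, one_mul]

theorem toEuclideanLin_gossipDev {P : Setting N K d T} (hP : P.Admissible) (x : Fin N → P.S → ℝ)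
    (s : P.S) (b : ℕ) (i : Fin N) : Matrix.toEuclideanLin P.W (P.gossipDev x s b) i =
      (∑ j, P.W i j * P.gossip x b j s) - 1 / N * ∑ j, x j s := by
  simp only [Matrix.toLpLin_apply, Matrix.mulVec, dotProduct, gossipDev, mul_sub,
    Finset.sum_sub_distrib]
  rw [← Finset.sum_mul, sum_row_of_mem_doublyStochastic hP.gossip.stochastic, one_mul]

theorem gossipDev_one {P : Setting N K d T} (hP : P.Admissible) (x : Fin N → P.S → ℝ) (s : P.S) :
    P.gossipDev x s 1 = (1 + P.kappa) • Matrix.toEuclideanLin P.W (P.gossipDev x s 0)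
      - P.kappa • P.gossipDev x s 0 := by
  ext i
  simp only [PiLp.sub_apply, PiLp.smul_apply, smul_eq_mul, toEuclideanLin_gossipDev hP]
  simp only [gossipDev, gossip_one_apply hP]
  ring

theorem gossipDev_add_two {P : Setting N K d T} (hP : P.Admissible) (x : Fin N → P.S → ℝ)
    (s : P.S) (b : ℕ) : P.gossipDev x s (b + 2) =
      (1 + P.kappa) • Matrix.toEuclideanLin P.W (P.gossipDev x s (b + 1))
        - P.kappa • P.gossipDev x s b := by
  ext i
  simp only [PiLp.sub_apply, PiLp.smul_apply, smul_eq_mul, toEuclideanLin_gossipDev hP]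
  simp only [gossipDev, gossip_add_two_apply hP]
  ring

/-- `W` preserves sums and the coefficients `1 + κ` and `-κ` add up to 1, so gossip preserves the
average. Thus the deviations stay where `W` is bounded by `σ₂`. -/
theorem sum_gossipDev {P : Setting N K d T} (hP : P.Admissible) (x : Fin N → P.S → ℝ) (s : P.S)
    (b : ℕ) : ∑ i, P.gossipDev x s b i = 0 := by
  have hN : (N : ℝ) ≠ 0 := by exact_mod_cast hP.pos_agents.ne'
  have h0 : ∑ i, P.gossipDev x s 0 i = 0 := by
    simp [gossipDev, gossip, Finset.sum_sub_distrib]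
    field_simp
    simp
  induction b using Nat.strong_induction_on with
  | _ b ih =>
    match b with
    | 0 => exact h0
    | 1 =>
      rw [gossipDev_one hP]
      simp only [PiLp.sub_apply, PiLp.smul_apply, smul_eq_mul, Finset.sum_sub_distrib,
        ← Finset.mul_sum, sum_toEuclideanLin_apply hP, h0]
      ring
    | b + 2 =>
      rw [gossipDev_add_two hP]
      simp only [PiLp.sub_apply, PiLp.smul_apply, smul_eq_mul, Finset.sum_sub_distrib,
        ← Finset.mul_sum, sum_toEuclideanLin_apply hP, ih b (by omega), ih (b + 1) (by omega)]
      ring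

theorem norm_gossipDev_le {P : Setting N K d T} (hP : P.Admissible) (x : Fin N → P.S → ℝ)
    (s : P.S) (b : ℕ) :
    ‖P.gossipDev x s b‖ ≤ (1 + 2 * b) * √P.kappa ^ b * ‖P.gossipDev x s 0‖ := by
  have : NeZero N := ⟨hP.pos_agents.ne'⟩
  refine norm_le_of_gossip_recurrence (W := Matrix.toEuclideanLin P.W) ?_ (sigma2_nonneg P.W)
    hP.sigma2_lt_one rfl
    (fun n => norm_toEuclideanLin_le hP.gossip.symm hP.gossip.stochastic hP.sigma2_lt_one _
      (sum_gossipDev hP x s n)) (gossipDev_one hP x s) (gossipDev_add_two hP x s) b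
  rw [Matrix.isSymmetric_toEuclideanLin_iff]
  exact hP.gossip.symm

/-- Subtracting the mean does not increase the sum of squares. -/
theorem norm_gossipDev_zero_le {P : Setting N K d T} (hP : P.Admissible) {x : Fin N → P.S → ℝ}
    {s : P.S} {R : ℝ} (hR : ∀ i, |x i s| ≤ R) : ‖P.gossipDev x s 0‖ ≤ √N * R := by
  have hN : (0 : ℝ) < N := by exact_mod_cast hP.pos_agents
  have hR0 : 0 ≤ R := (abs_nonneg _).trans (hR ⟨0, hP.pos_agents⟩)
  rw [EuclideanSpace.norm_eq]
  have e : ∑ i, ‖P.gossipDev x s 0 i‖ ^ 2 ≤ N * R ^ 2 := by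
    set m := ∑ j, x j s with hm
    have h1 : ∑ i, ‖P.gossipDev x s 0 i‖ ^ 2 = ∑ i, x i s ^ 2 - m ^ 2 / N := by
      simp only [gossipDev, gossip, Real.norm_eq_abs, sq_abs, ← hm, sub_sq,
        Finset.sum_add_distrib, Finset.sum_sub_distrib, ← Finset.sum_mul, ← Finset.mul_sum]
      simp
      field_simp
      ring
    have h2 : ∑ i, x i s ^ 2 ≤ ∑ _i : Fin N, R ^ 2 :=
      Finset.sum_le_sum fun i _ => sq_le_sq' (neg_le_of_abs_le (hR i)) (le_of_abs_le (hR i))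
    have h3 : 0 ≤ m ^ 2 / N := by positivity
    simp at h2
    linarith
  calc √(∑ i, ‖P.gossipDev x s 0 i‖ ^ 2) ≤ √(N * R ^ 2) := Real.sqrt_le_sqrt e
    _ = √N * R := by rw [Real.sqrt_mul hN.le, Real.sqrt_sq hR0]

theorem sqrt_kappa_pow_blockLen_le {P : Setting N K d T} (hP : P.Admissible) (hK : 0 < K)
    (hT : 0 < T) : √P.kappa ^ P.blockLen ≤ 1 / (((K : ℝ) * T) ^ 6 * √(14 * N)) := by
  have hN : (0 : ℝ) < N := by exact_mod_cast hP.pos_agents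
  set c := (1 - 1 / √2) * √(1 - sigma2 P.W) with hc
  have hc0 : 0 < c := by
    refine mul_pos ?_ (Real.sqrt_pos.2 (by linarith [hP.sigma2_lt_one]))
    rw [sub_pos, div_lt_one (by positivity)]
    exact Real.lt_sqrt_of_sq_lt (by norm_num)
  set Q := ((K : ℝ) * T) ^ 6 * √(14 * N) with hQ
  have hQ0 : 0 < Q := by positivity
  have hB : Real.log Q ≤ c * P.blockLen := by
    have : Real.log Q / c ≤ P.blockLen := Nat.le_ceil _
    rwa [div_le_iff₀' hc0] at this
  calc √P.kappa ^ P.blockLen ≤ Real.exp (-c) ^ P.blockLen := by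
        refine pow_le_pow_left₀ (Real.sqrt_nonneg _) ?_ _
        exact sqrt_kappa_le (sigma2_nonneg _) hP.sigma2_lt_one
    _ = Real.exp (-(c * P.blockLen)) := by rw [← Real.exp_nat_mul]; ring_nf
    _ ≤ Real.exp (-Real.log Q) := Real.exp_le_exp.2 (by linarith)
    _ = 1 / Q := by rw [Real.exp_neg, Real.exp_log hQ0, one_div]

/-- After a whole block of gossip all agents agree up to a negligible error, provided that there
are at least two blocks. -/
theorem abs_gossip_sub_le {P : Setting N K d T} (hP : P.Admissible) (hK : 0 < K) (hT : 3 ≤ T)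
    (hB : P.blockLen < T) {x : Fin N → P.S → ℝ} {R : ℝ} (hR : ∀ i s, |x i s| ≤ R) (i : Fin N)
    (s : P.S) : |P.gossip x P.blockLen i s - 1 / N * ∑ j, x j s| ≤ R / (K * T ^ 2) := by
  have hN : (0 : ℝ) < N := by exact_mod_cast hP.pos_agents
  have hR0 : 0 ≤ R := (abs_nonneg _).trans (hR i s)
  have hK1 : (1 : ℝ) ≤ K := by exact_mod_cast hK
  have hT3 : (3 : ℝ) ≤ T := by exact_mod_cast hT
  have hB1 : (P.blockLen : ℝ) + 1 ≤ T := by exact_mod_cast hB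
  have h1 : |P.gossip x P.blockLen i s - 1 / N * ∑ j, x j s| ≤ ‖P.gossipDev x s P.blockLen‖ := by
    have := PiLp.norm_apply_le (P.gossipDev x s P.blockLen) i
    simpa [gossipDev] using this
  have h14 : √(14 * N) = √14 * √N := Real.sqrt_mul (by norm_num) _
  have h2 : 1 ≤ √(14 : ℝ) := Real.one_le_sqrt.2 (by norm_num)
  have hsN : 0 < √(N : ℝ) := Real.sqrt_pos.2 hN
  calc _ ≤ _ := h1
    _ ≤ (1 + 2 * P.blockLen) * √P.kappa ^ P.blockLen * ‖P.gossipDev x s 0‖ :=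
        norm_gossipDev_le hP x s _
    -- `1 + 2B ≤ 2T` uses `B < T`; the factor `√N` cancels against `√(14N)`.
    _ ≤ (2 * T) * (1 / (((K : ℝ) * T) ^ 6 * √(14 * N))) * (√N * R) := by
        gcongr
        · linarith
        · exact sqrt_kappa_pow_blockLen_le hP hK (by omega)
        · exact norm_gossipDev_zero_le hP fun j => hR j s
    _ = R * (2 * T / (((K : ℝ) * T) ^ 6 * √14)) := by
        rw [h14]; field_simp
    _ ≤ R * (1 / (K * T ^ 2)) := by
        refine mul_le_mul_of_nonneg_left ?_ hR0
        rw [div_le_div_iff₀ (by positivity) (by positivity), one_mul]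
        have h3 : (T : ℝ) * T ^ 3 ≤ T ^ 6 := by
          rw [← pow_succ']
          exact pow_le_pow_right₀ (by linarith) (by norm_num)
        have h4 : (K : ℝ) ≤ K ^ 6 := le_self_pow₀ hK1 (by norm_num)
        calc 2 * (T : ℝ) * (K * T ^ 2) = K * (2 * T ^ 3) := by ring
          _ ≤ (K : ℝ) ^ 6 * (T * T ^ 3) := by gcongr; linarith
          _ ≤ (K : ℝ) ^ 6 * T ^ 6 * 1 := by rw [mul_one]; gcongr
          _ ≤ (K * T) ^ 6 * √14 := by rw [mul_pow]; gcongr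
    _ = _ := by ring

end Setting

/-! ### Exponential weights. -/

/-- The exponential weights `exp (-η L k) / ∑ j, exp (-η L j)`. -/
def expWeights {K : ℕ} (η : ℝ) (L : Fin K → ℝ) (k : Fin K) : ℝ :=
  Real.exp (-(η * L k)) / ∑ j, Real.exp (-(η * L j))

section ExpWeights

variable {K : ℕ} {η : ℝ}

theorem sum_exp_pos (hK : 0 < K) (L : Fin K → ℝ) : 0 < ∑ j, Real.exp (-(η * L j)) :=
  Finset.sum_pos (fun _ _ => Real.exp_pos _) ⟨⟨0, hK⟩, Finset.mem_univ _⟩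

theorem expWeights_pos (hK : 0 < K) (L : Fin K → ℝ) (k : Fin K) : 0 < expWeights η L k :=
  div_pos (Real.exp_pos _) (sum_exp_pos hK L)

theorem sum_expWeights (hK : 0 < K) (L : Fin K → ℝ) : ∑ k, expWeights η L k = 1 := by
  simp only [expWeights]
  rw [← Finset.sum_div, div_self (sum_exp_pos hK L).ne']

theorem expWeights_mem (hK : 0 < K) (L : Fin K → ℝ) : expWeights η L ∈ stdSimplex ℝ (Fin K) :=
  ⟨fun k => (expWeights_pos hK L k).le, sum_expWeights hK L⟩

theorem expWeights_zero : expWeights η (0 : Fin K → ℝ) = fun _ => 1 / (K : ℝ) := by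
  funext k
  simp [expWeights]

/-- The regularized objective, up to a constant, is the relative entropy with respect to the
exponential weights. -/
theorem objective_eq (hK : 0 < K) (hη : 0 < η) (L : Fin K → ℝ) {q : Fin K → ℝ}
    (hq : q ∈ stdSimplex ℝ (Fin K)) : L ⬝ᵥ q + entropyReg η q =
      1 / η * ∑ k, expWeights η L k * InformationTheory.klFun (q k / expWeights η L k)
        - 1 / η * Real.log (∑ j, Real.exp (-(η * L j))) := by
  set Z := ∑ j, Real.exp (-(η * L j)) with hZ
  have hZ0 : 0 < Z := sum_exp_pos hK L
  have hlog : ∀ k, Real.log (expWeights η L k) = -(η * L k) - Real.log Z := fun k => by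
    rw [expWeights, Real.log_div (Real.exp_pos _).ne' hZ0.ne', Real.log_exp]
  have hterm : ∀ k, expWeights η L k * InformationTheory.klFun (q k / expWeights η L k) =
      q k * Real.log (q k) + η * (L k * q k) + q k * Real.log Z
        + expWeights η L k - q k := by
    intro k
    have hp := expWeights_pos (η := η) hK L k
    rw [InformationTheory.klFun_apply]
    rcases (hq.1 k).eq_or_lt with h0 | h0
    · rw [← h0]; simp
    · rw [Real.log_div h0.ne' hp.ne', hlog]
      field_simp
      ring
  simp only [hterm, Finset.sum_add_distrib, Finset.sum_sub_distrib, ← Finset.mul_sum,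
    ← Finset.sum_mul, hq.2, sum_expWeights hK, entropyReg, dotProduct]
  field_simp
  ring

/-- Relative entropy is nonnegative and vanishes only at equality, so the minimizer is unique and
the arbitrary choice in `ftrlArgmin` is harmless. -/
theorem ftrlArgmin_eq (hK : 0 < K) (hη : 0 < η) (L : Fin K → ℝ) :
    ftrlArgmin η L = expWeights η L := by
  obtain ⟨hq, hmin⟩ := ftrlArgmin_spec hK η L
  set q := ftrlArgmin η L
  have h1 : L ⬝ᵥ q + entropyReg η q ≤ L ⬝ᵥ expWeights η L + entropyReg η (expWeights η L) :=
    hmin (expWeights_mem hK L)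
  rw [objective_eq hK hη L hq, objective_eq hK hη L (expWeights_mem hK L)] at h1
  have h2 : ∀ k, expWeights η L k *
      InformationTheory.klFun (expWeights η L k / expWeights η L k) = 0 := fun k => by
    rw [div_self (expWeights_pos hK L k).ne', InformationTheory.klFun_one, mul_zero]
  have hnn : ∀ k, 0 ≤ q k / expWeights η L k := fun k =>
    div_nonneg (hq.1 k) (expWeights_pos hK L k).le
  have hnn' : ∀ k, 0 ≤ expWeights η L k * InformationTheory.klFun (q k / expWeights η L k) :=
    fun k => mul_nonneg (expWeights_pos hK L k).le (InformationTheory.klFun_nonneg (hnn k))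
  simp only [h2, Finset.sum_const_zero, mul_zero, zero_sub] at h1
  have h3 : ∑ k, expWeights η L k * InformationTheory.klFun (q k / expWeights η L k) ≤ 0 := by
    have : 1 / η * ∑ k, expWeights η L k * InformationTheory.klFun (q k / expWeights η L k) ≤ 0 := by
      linarith
    exact nonpos_of_mul_nonpos_right this (by positivity)
  have h4 := (Finset.sum_eq_zero_iff_of_nonneg fun k _ => hnn' k).1
    (le_antisymm h3 (Finset.sum_nonneg fun k _ => hnn' k))
  funext k
  have h5 := (mul_eq_zero.1 (h4 k (Finset.mem_univ k))).resolve_left (expWeights_pos hK L k).ne'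
  rw [InformationTheory.klFun_eq_zero_iff (hnn k)] at h5
  exact (div_eq_one_iff_eq (expWeights_pos hK L k).ne').1 h5

/-- Exponential weights of nearby losses are multiplicatively close. -/
theorem expWeights_le_exp_mul (hK : 0 < K) (hη : 0 ≤ η) {L L' : Fin K → ℝ} {D : ℝ}
    (h : ∀ k, |L k - L' k| ≤ D) (k : Fin K) :
    expWeights η L k ≤ Real.exp (2 * (η * D)) * expWeights η L' k := by
  have hexp : ∀ {M M' : Fin K → ℝ}, (∀ k, M' k ≤ M k + D) → ∀ k,
      Real.exp (-(η * M k)) ≤ Real.exp (η * D) * Real.exp (-(η * M' k)) := by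
    intro M M' hM k
    rw [← Real.exp_add, Real.exp_le_exp]
    nlinarith [mul_le_mul_of_nonneg_left (hM k) hη]
  have h1 : ∀ k, L' k ≤ L k + D := fun k => by linarith [(abs_le.1 (h k)).1]
  have h2 : ∀ k, L k ≤ L' k + D := fun k => by linarith [(abs_le.1 (h k)).2]
  have hsum : ∑ j, Real.exp (-(η * L' j)) ≤ Real.exp (η * D) * ∑ j, Real.exp (-(η * L j)) := by
    rw [Finset.mul_sum]
    exact Finset.sum_le_sum fun j _ => hexp h2 j
  have hZ := sum_exp_pos (η := η) hK L
  have hZ' := sum_exp_pos (η := η) hK L'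
  have he := Real.exp_pos (η * D)
  rw [expWeights, expWeights, two_mul, Real.exp_add, ← mul_div_assoc, div_le_div_iff₀ hZ hZ']
  calc _ ≤ (Real.exp (η * D) * Real.exp (-(η * L' k))) *
        (Real.exp (η * D) * ∑ j, Real.exp (-(η * L j))) :=
        mul_le_mul (hexp h1 k) hsum hZ'.le (by positivity)
    _ = _ := by ring

/-- Squaring the second-order bound for `exp (y / 2)`. The range is 2 rather than 1 to leave room
for the gossip error in the losses. -/
theorem exp_le_quadratic {y : ℝ} (h : |y| ≤ 2) : Real.exp y ≤ 1 + y + 2 * y ^ 2 := by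
  have h1 : |y / 2| ≤ 1 := by rw [abs_div, abs_two]; linarith
  have h2 := (abs_le.1 (Real.abs_exp_sub_one_sub_id_le h1)).2
  have h3 : Real.exp y = Real.exp (y / 2) ^ 2 := by rw [← Real.exp_nat_mul]; congr 1; push_cast; ring
  have h4 : Real.exp (y / 2) ≤ 1 + y / 2 + (y / 2) ^ 2 := by linarith
  rw [h3]
  calc _ ≤ (1 + y / 2 + (y / 2) ^ 2) ^ 2 := pow_le_pow_left₀ (Real.exp_pos _).le h4 2
    _ ≤ _ := by
      obtain ⟨h5, h6⟩ := abs_le.1 h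
      nlinarith [mul_nonneg (sq_nonneg y) (sub_nonneg.2 h6),
        mul_nonneg (sq_nonneg y) (mul_nonneg (sub_nonneg.2 h6) (by linarith : (0 : ℝ) ≤ 2 + y))]

/-- The regret bound of the exponential weights algorithm. -/
theorem expWeights_regret (hK : 0 < K) (hη : 0 < η) (Z : ℕ → Fin K → ℝ)
    (hZ : ∀ n k, |η * Z n k| ≤ 2) (n : ℕ) (k₀ : Fin K) :
    ∑ m ∈ Finset.range n, (∑ k, expWeights η (∑ l ∈ Finset.range m, Z l) k * Z m k - Z m k₀) ≤
      Real.log K / η + 2 * η * ∑ m ∈ Finset.range n,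
        ∑ k, expWeights η (∑ l ∈ Finset.range m, Z l) k * Z m k ^ 2 := by
  set L : ℕ → Fin K → ℝ := fun m => ∑ l ∈ Finset.range m, Z l with hL
  set Φ : ℕ → ℝ := fun m => Real.log (∑ k, Real.exp (-(η * L m k))) with hΦ
  -- The potential is the logarithm of the normalizer, whose ratio over one step is the mean of `exp
  -- (-η Z m)` under the current weights.
  have hstep : ∀ m, Φ (m + 1) ≤ Φ m - η * ∑ k, expWeights η (L m) k * Z m k
      + 2 * η ^ 2 * ∑ k, expWeights η (L m) k * Z m k ^ 2 := by
    intro m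
    have hpos := sum_exp_pos (η := η) hK (L m)
    have e1 : ∑ k, Real.exp (-(η * L (m + 1) k)) = (∑ k, Real.exp (-(η * L m k))) *
        ∑ k, expWeights η (L m) k * Real.exp (-(η * Z m k)) := by
      rw [Finset.mul_sum]
      refine Finset.sum_congr rfl fun k _ => ?_
      have : L (m + 1) k = L m k + Z m k := by simp [hL, Finset.sum_range_succ]
      rw [this, mul_add, neg_add, Real.exp_add, expWeights]
      field_simp
    have e2 : ∑ k, expWeights η (L m) k * Real.exp (-(η * Z m k)) ≤
        1 + (- η * ∑ k, expWeights η (L m) k * Z m k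
          + 2 * η ^ 2 * ∑ k, expWeights η (L m) k * Z m k ^ 2) := by
      calc _ ≤ ∑ k, expWeights η (L m) k * (1 + -(η * Z m k) + 2 * (-(η * Z m k)) ^ 2) := by
            refine Finset.sum_le_sum fun k _ => mul_le_mul_of_nonneg_left ?_
              (expWeights_pos hK _ k).le
            exact exp_le_quadratic (by rw [abs_neg]; exact hZ m k)
        _ = ∑ k, (expWeights η (L m) k + (-η * (expWeights η (L m) k * Z m k)
              + 2 * η ^ 2 * (expWeights η (L m) k * Z m k ^ 2))) :=
            Finset.sum_congr rfl fun k _ => by ring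
        _ = _ := by
            rw [Finset.sum_add_distrib, Finset.sum_add_distrib, ← Finset.mul_sum,
              ← Finset.mul_sum, sum_expWeights hK]
    have e3 : 0 < ∑ k, expWeights η (L m) k * Real.exp (-(η * Z m k)) :=
      Finset.sum_pos (fun k _ => mul_pos (expWeights_pos hK _ k) (Real.exp_pos _))
        ⟨⟨0, hK⟩, Finset.mem_univ _⟩
    have e4 := Real.log_le_sub_one_of_pos e3
    simp only [hΦ]
    rw [e1, Real.log_mul hpos.ne' e3.ne']
    linarith
  have htel : ∀ n, Φ n ≤ Real.log K + ∑ m ∈ Finset.range n,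
      (- η * ∑ k, expWeights η (L m) k * Z m k
        + 2 * η ^ 2 * ∑ k, expWeights η (L m) k * Z m k ^ 2) := by
    intro n
    induction n with
    | zero => simp [hΦ, hL]
    | succ n ih =>
      rw [Finset.sum_range_succ]
      linarith [hstep n]
  have hlow : -(η * L n k₀) ≤ Φ n := by
    rw [← Real.log_exp (-(η * L n k₀))]
    exact Real.log_le_log (Real.exp_pos _)
      (Finset.single_le_sum (f := fun k => Real.exp (-(η * L n k)))
        (fun k _ => (Real.exp_pos _).le) (Finset.mem_univ k₀))
  have h1 := hlow.trans (htel n)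
  rw [Finset.sum_add_distrib, ← Finset.mul_sum, ← Finset.mul_sum] at h1
  have h2 : L n k₀ = ∑ m ∈ Finset.range n, Z m k₀ := by simp [hL, Finset.sum_apply]
  rw [Finset.sum_sub_distrib, ← h2]
  have h3 : η * (∑ m ∈ Finset.range n, ∑ k, expWeights η (L m) k * Z m k - L n k₀) ≤
      η * (Real.log K / η + 2 * η * ∑ m ∈ Finset.range n,
        ∑ k, expWeights η (L m) k * Z m k ^ 2) := by
    have : η * (Real.log K / η) = Real.log K := by field_simp
    rw [mul_add η, this]
    nlinarith [h1]
  exact le_of_mul_le_mul_left h3 hη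

end ExpWeights

/-- The regret bound when the even and the odd rounds are handled by separate copies of the
exponential weights algorithm. -/
theorem expWeights_regret_interleaved {K : ℕ} {η : ℝ} (hK : 0 < K) (hη : 0 < η)
    (Z : ℕ → Fin K → ℝ) (hZ : ∀ n k, |η * Z n k| ≤ 2) (n : ℕ) (k₀ : Fin K)
    (p : ℕ → Fin K → ℝ)
    (hp : ∀ m, p m = expWeights η (∑ l ∈ Finset.range m with l % 2 = m % 2, Z l)) :
    ∑ m ∈ Finset.range n, (∑ k, p m k * Z m k - Z m k₀) ≤
      2 * (Real.log K / η) + 2 * η * ∑ m ∈ Finset.range n, ∑ k, p m k * Z m k ^ 2 := by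
  have hc : ∀ c : ℕ, ∑ m ∈ Finset.range n with m % 2 = c, (∑ k, p m k * Z m k - Z m k₀) ≤
      Real.log K / η + 2 * η * ∑ m ∈ Finset.range n with m % 2 = c, ∑ k, p m k * Z m k ^ 2 := by
    intro c
    -- A copy that is idle in a round behaves as if it received zero loss there, so the bound for a
    -- single learner applies to it.
    have key := expWeights_regret hK hη (fun m => if m % 2 = c then Z m else 0) (fun m k => by
      by_cases h : m % 2 = c
      · simpa [h] using hZ m k
      · simp [h]) n k₀
    rw [Finset.sum_filter, Finset.sum_filter]
    convert key using 1
    · refine Finset.sum_congr rfl fun m _ => ?_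
      by_cases h : m % 2 = c
      · simp [h, hp, Finset.sum_filter]
      · simp [h]
    · congr 2
      refine Finset.sum_congr rfl fun m _ => ?_
      by_cases h : m % 2 = c
      · simp [h, hp, Finset.sum_filter]
      · simp [h]
  have hsplit : ∀ f : ℕ → ℝ, ∑ m ∈ Finset.range n, f m =
      (∑ m ∈ Finset.range n with m % 2 = 0, f m) + ∑ m ∈ Finset.range n with m % 2 = 1, f m := by
    intro f
    rw [← Finset.sum_filter_add_sum_filter_not (Finset.range n) (fun m => m % 2 = 0) f]
    congr 2
    ext m
    simp
  rw [hsplit, hsplit (fun m => ∑ k, p m k * Z m k ^ 2)]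
  linarith [hc 0, hc 1]

/-! ### The correlation matrix and the loss estimates. -/

namespace Setting

variable {N K d T : ℕ} {P : Setting N K d T} {p : Fin K → ℝ}

/-- The estimate, formed after agent `i` has played `m`, of the loss of action `k`. -/
def actEst (P : Setting N K d T) (p : Fin K → ℝ) (t : Fin T) (i : Fin N) (m k : Fin K) : ℝ :=
  P.loss t i m * (P.a k ⬝ᵥ (P.corrMatrix p)⁻¹.mulVec (P.a m))

theorem lossEst_apply (t : Fin T) (i : Fin N) (m : Fin K) (s : P.S) :
    P.lossEst p t i m s = P.actEst p t i m s := by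
  simp [lossEst, thetaEst, actEst, Matrix.mulVec_smul]

theorem reconstruct_sum {ι : Type*} (I : Finset ι) (z : ι → P.S → ℝ) :
    P.reconstruct (∑ i ∈ I, z i) = ∑ i ∈ I, P.reconstruct (z i) := by
  funext k
  simp only [reconstruct, Finset.sum_apply, Finset.mul_sum]
  exact Finset.sum_comm

/-- The estimate is linear in the vector `a k`, so the spanner coordinates determine it exactly. -/
theorem reconstruct_lossEst (hP : P.Admissible) (t : Fin T) (i : Fin N) (m k : Fin K) :
    P.reconstruct (P.lossEst p t i m) k = P.actEst p t i m k := by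
  simp only [reconstruct, lossEst_apply, actEst]
  conv_rhs => rw [(hP.spanner k).1]
  rw [sum_dotProduct, Finset.mul_sum]
  refine Finset.sum_congr rfl fun s _ => ?_
  rw [smul_dotProduct, smul_eq_mul]
  ring

theorem corrMatrix_mulVec (v : Fin d → ℝ) :
    (P.corrMatrix p).mulVec v = ∑ k, (p k * (P.a k ⬝ᵥ v)) • P.a k := by
  rw [corrMatrix, Matrix.sum_mulVec]
  refine Finset.sum_congr rfl fun k _ => ?_
  rw [Matrix.smul_mulVec, Matrix.vecMulVec_mulVec, mul_smul]
  simp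

theorem dotProduct_corrMatrix_mulVec (u v : Fin d → ℝ) :
    u ⬝ᵥ (P.corrMatrix p).mulVec v = ∑ k, p k * ((P.a k ⬝ᵥ u) * (P.a k ⬝ᵥ v)) := by
  rw [corrMatrix_mulVec, dotProduct_sum]
  refine Finset.sum_congr rfl fun k _ => ?_
  rw [dotProduct_smul, smul_eq_mul, dotProduct_comm u]
  ring

theorem eq_zero_of_dotProduct_eq_zero (hP : P.Admissible) {v : Fin d → ℝ}
    (h : ∀ k, P.a k ⬝ᵥ v = 0) : v = 0 := by
  have h1 : ∀ u ∈ Submodule.span ℝ (Set.range P.a), u ⬝ᵥ v = 0 := by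
    intro u hu
    induction hu using Submodule.span_induction with
    | mem x hx => obtain ⟨k, rfl⟩ := hx; exact h k
    | zero => simp
    | add x y _ _ hx hy => rw [add_dotProduct, hx, hy, add_zero]
    | smul c x _ hx => rw [smul_dotProduct, hx, smul_zero]
  rw [hP.span] at h1
  exact dotProduct_self_eq_zero.1 (h1 v trivial)

/-- The quadratic form is `∑ k, p k * ⟨a k, v⟩²`; since all weights are positive and the actions
span, it vanishes only at 0. -/
theorem isUnit_det_corrMatrix (hP : P.Admissible) (hp : ∀ k, 0 < p k) :
    IsUnit (P.corrMatrix p).det := by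
  rw [isUnit_iff_ne_zero]
  intro h
  obtain ⟨v, hv, hv0⟩ := Matrix.exists_mulVec_eq_zero_iff.2 h
  refine hv (eq_zero_of_dotProduct_eq_zero hP fun k => ?_)
  have h1 := dotProduct_corrMatrix_mulVec (P := P) (p := p) v v
  rw [hv0, dotProduct_zero, eq_comm, Finset.sum_eq_zero_iff_of_nonneg
    fun k _ => mul_nonneg (hp k).le (mul_self_nonneg _)] at h1
  exact mul_self_eq_zero.1 ((mul_eq_zero.1 (h1 k (Finset.mem_univ k))).resolve_left (hp k).ne')

theorem dotProduct_corrMatrix_inv_comm (u v : Fin d → ℝ) :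
    u ⬝ᵥ (P.corrMatrix p)⁻¹.mulVec v = v ⬝ᵥ (P.corrMatrix p)⁻¹.mulVec u := by
  have h : ((P.corrMatrix p)⁻¹).transpose = (P.corrMatrix p)⁻¹ := by
    rw [Matrix.transpose_nonsing_inv]
    congr 1
    rw [corrMatrix, Matrix.transpose_sum]
    refine Finset.sum_congr rfl fun k _ => ?_
    rw [Matrix.transpose_smul, Matrix.transpose_vecMulVec]
  rw [dotProduct_comm, ← Matrix.vecMul_transpose, h, ← Matrix.dotProduct_mulVec]

/-- `M⁻¹ M = 1`, written as an average over the played action. Both the mean and the second moment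
of the estimates reduce to it. -/
theorem sum_mul_dotProduct_inv (hP : P.Admissible) (hp : ∀ k, 0 < p k) (u v : Fin d → ℝ) :
    ∑ k, p k * ((P.a k ⬝ᵥ v) * (u ⬝ᵥ (P.corrMatrix p)⁻¹.mulVec (P.a k))) = u ⬝ᵥ v := by
  simp only [dotProduct_corrMatrix_inv_comm u]
  rw [← dotProduct_corrMatrix_mulVec, Matrix.mulVec_mulVec,
    Matrix.mul_nonsing_inv _ (isUnit_det_corrMatrix hP hp), Matrix.one_mulVec, dotProduct_comm]

/-- The estimates are unbiased. -/
theorem sum_mul_actEst (hP : P.Admissible) (hp : ∀ k, 0 < p k) (t : Fin T) (i : Fin N)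
    (k : Fin K) : ∑ m, p m * P.actEst p t i m k = P.loss t i k := by
  rw [loss, dotProduct_comm, ← sum_mul_dotProduct_inv hP hp]
  simp only [actEst, loss, dotProduct_comm]

theorem sum_mul_actEst_sq_le (hP : P.Admissible) (hp : ∀ k, 0 < p k) (t : Fin T) (i : Fin N)
    (k : Fin K) : ∑ m, p m * P.actEst p t i m k ^ 2 ≤
      P.a k ⬝ᵥ (P.corrMatrix p)⁻¹.mulVec (P.a k) := by
  rw [← sum_mul_dotProduct_inv hP hp (P.a k) ((P.corrMatrix p)⁻¹.mulVec (P.a k))]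
  refine Finset.sum_le_sum fun m _ => mul_le_mul_of_nonneg_left ?_ (hp m).le
  rw [actEst, mul_pow, dotProduct_corrMatrix_inv_comm (P.a m), ← sq]
  have h1 : P.loss t i m ^ 2 ≤ 1 := by
    rw [sq_le_one_iff_abs_le_one, abs_le]
    exact hP.loss_mem t i m
  exact mul_le_of_le_one_left (sq_nonneg _) h1

theorem dotProduct_inv_self_nonneg (hP : P.Admissible) (hp : ∀ k, 0 < p k) (u : Fin d → ℝ) :
    0 ≤ u ⬝ᵥ (P.corrMatrix p)⁻¹.mulVec u := by
  rw [← sum_mul_dotProduct_inv hP hp u ((P.corrMatrix p)⁻¹.mulVec u)]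
  refine Finset.sum_nonneg fun m _ => mul_nonneg (hp m).le ?_
  rw [dotProduct_corrMatrix_inv_comm (P.a m)]
  exact mul_self_nonneg _

/-- The left side is the trace of `M⁻¹ M`. Thus the variance, averaged over actions, costs `d` and
not `K`. -/
theorem sum_mul_dotProduct_inv_self (hP : P.Admissible) (hp : ∀ k, 0 < p k) :
    ∑ k, p k * (P.a k ⬝ᵥ (P.corrMatrix p)⁻¹.mulVec (P.a k)) = d := by
  have h : ((P.corrMatrix p)⁻¹ * P.corrMatrix p).trace = d := by
    rw [Matrix.nonsing_inv_mul _ (isUnit_det_corrMatrix hP hp), Matrix.trace_one, Fintype.card_fin]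
  rw [← h]
  conv_rhs => rw [corrMatrix, Finset.mul_sum, Matrix.trace_sum]
  refine Finset.sum_congr rfl fun k _ => ?_
  rw [Matrix.mul_smul, Matrix.trace_smul, Matrix.mul_vecMulVec, Matrix.trace_vecMulVec,
    dotProduct_comm, smul_eq_mul, corrMatrix]

/-- Exploration of the spanner bounds the estimates. -/
theorem abs_dotProduct_inv_le (hP : P.Admissible) (hp : ∀ k, 0 < p k) {c : ℝ} (hc : 0 < c)
    (hS : ∀ k ∈ P.S, c ≤ p k) (m k : Fin K) :
    |P.a k ⬝ᵥ (P.corrMatrix p)⁻¹.mulVec (P.a m)| ≤ 1 / c := by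
  set v := (P.corrMatrix p)⁻¹.mulVec (P.a m) with hv
  have hMv : v ⬝ᵥ (P.corrMatrix p).mulVec v = P.a m ⬝ᵥ v := by
    rw [hv, Matrix.mulVec_mulVec, Matrix.mul_nonsing_inv _ (isUnit_det_corrMatrix hP hp),
      Matrix.one_mulVec, dotProduct_comm]
  -- The spanner part of the quadratic form `v ⬝ᵥ M v` is at least `c ∑ j, ⟨b j, v⟩²`, which by
  -- Cauchy–Schwarz and `‖lam k‖₂ ≤ 1` dominates `c ⟨a k, v⟩²`.
  have h1 : ∀ k, c * (P.a k ⬝ᵥ v) ^ 2 ≤ P.a m ⬝ᵥ v := by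
    intro k
    have e : P.a k ⬝ᵥ v = ∑ j : P.S, P.lam k j * (P.a j ⬝ᵥ v) := by
      conv_lhs => rw [(hP.spanner k).1]
      rw [sum_dotProduct]
      exact Finset.sum_congr rfl fun j _ => by rw [smul_dotProduct, smul_eq_mul]
    have h2 : (P.a k ⬝ᵥ v) ^ 2 ≤ ∑ j : P.S, (P.a j ⬝ᵥ v) ^ 2 := by
      rw [e]
      refine (Finset.sum_mul_sq_le_sq_mul_sq _ _ _).trans ?_
      have h3 : ∑ j : P.S, P.lam k j ^ 2 ≤ 1 := by
        have := (hP.spanner k).2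
        rwa [Real.sqrt_le_one] at this
      exact mul_le_of_le_one_left (Finset.sum_nonneg fun _ _ => sq_nonneg _) h3
    calc c * (P.a k ⬝ᵥ v) ^ 2 ≤ c * ∑ j : P.S, (P.a j ⬝ᵥ v) ^ 2 := by gcongr
      _ = ∑ j ∈ P.S, c * (P.a j ⬝ᵥ v) ^ 2 := by
        rw [Finset.mul_sum]
        exact Finset.sum_coe_sort P.S fun j => c * (P.a j ⬝ᵥ v) ^ 2
      _ ≤ ∑ j ∈ P.S, p j * (P.a j ⬝ᵥ v) ^ 2 :=
        Finset.sum_le_sum fun j hj => mul_le_mul_of_nonneg_right (hS j hj) (sq_nonneg _)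
      _ ≤ ∑ j, p j * (P.a j ⬝ᵥ v) ^ 2 :=
        Finset.sum_le_univ_sum_of_nonneg fun j => mul_nonneg (hp j).le (sq_nonneg _)
      _ = P.a m ⬝ᵥ v := by
        rw [← hMv, dotProduct_corrMatrix_mulVec]
        simp only [sq]
  -- The previous bound at `k = m` reads `c x² ≤ x`.
  have h2 : P.a m ⬝ᵥ v ≤ 1 / c := by
    rw [le_div_iff₀ hc]
    have h3 := h1 m
    by_contra h4
    push Not at h4
    nlinarith
  refine abs_le_of_sq_le_sq ?_ (by positivity)
  have h3 := (h1 k).trans h2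
  calc (P.a k ⬝ᵥ v) ^ 2 = (c * (P.a k ⬝ᵥ v) ^ 2) * (1 / c) := by field_simp
    _ ≤ (1 / c) * (1 / c) := by gcongr
    _ = _ := by ring

theorem abs_actEst_le (hP : P.Admissible) (hp : ∀ k, 0 < p k) {c : ℝ} (hc : 0 < c)
    (hS : ∀ k ∈ P.S, c ≤ p k) (t : Fin T) (i : Fin N) (m k : Fin K) :
    |P.actEst p t i m k| ≤ 1 / c := by
  rw [actEst, abs_mul]
  have h1 : |P.loss t i m| ≤ 1 := abs_le.2 (hP.loss_mem t i m)
  exact (mul_le_of_le_one_left (abs_nonneg _) h1).trans (abs_dotProduct_inv_le hP hp hc hS m k)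

end Setting

/-! ### Conditioning on the past of a sequence of draws -/

/-- The draw at time `t` may be averaged out if the integrand does not look beyond it. -/
theorem sum_prod_mul_eq {X : Type*} [Fintype X] [Nonempty X] (T : ℕ)
    (g : Fin T → (Fin T → X) → X → ℝ)
    (hg : ∀ t A A', (∀ s, s < t → A s = A' s) → g t A = g t A')
    (h1 : ∀ t A, ∑ x, g t A x = 1) (t : Fin T) (F : (Fin T → X) → X → ℝ)
    (hF : ∀ A A', (∀ s, s < t → A s = A' s) → F A = F A') :
    ∑ A : Fin T → X, (∏ s, g s A (A s)) * F A (A t) =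
      ∑ A : Fin T → X, (∏ s, g s A (A s)) * ∑ x, g t A x * F A x := by
  induction T with
  | zero => exact t.elim0
  | succ T ih =>
    obtain ⟨x₀⟩ := ‹Nonempty X›
    have hsnoc : ∀ (A : Fin T → X) (x y : X) (t s : Fin (T + 1)), s < t →
        (Fin.snoc A x : Fin (T + 1) → X) s = (Fin.snoc A y : Fin (T + 1) → X) s := by
      intro A x y t s hs
      have hs' : s ≠ Fin.last T := (hs.trans_le (Fin.le_last t)).ne
      obtain ⟨s, rfl⟩ := Fin.exists_castSucc_eq.2 hs'
      simp
    -- No `g t` looks at the last draw of its trajectory argument, so an arbitrary `x₀` can fill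
    -- that slot and the last draw can be summed separately.
    have key : ∀ (A : Fin T → X) (x : X), ∏ t, g t (Fin.snoc A x : Fin (T + 1) → X)
        ((Fin.snoc A x : Fin (T + 1) → X) t) =
        (∏ t : Fin T, g t.castSucc (Fin.snoc A x₀ : Fin (T + 1) → X) (A t)) *
          g (Fin.last T) (Fin.snoc A x₀ : Fin (T + 1) → X) x := by
      intro A x
      have hc : ∀ t, g t (Fin.snoc A x : Fin (T + 1) → X) = g t (Fin.snoc A x₀) :=
        fun t => hg t _ _ (hsnoc A x x₀ t)
      rw [Fin.prod_univ_castSucc]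
      simp [hc]
    have hsum : ∀ f : (Fin (T + 1) → X) → ℝ, ∑ A, f A =
        ∑ A : Fin T → X, ∑ x, f (Fin.snoc A x : Fin (T + 1) → X) := by
      intro f
      rw [← (Fin.snocEquiv fun _ : Fin (T + 1) => X).sum_comp, Fintype.sum_prod_type,
        Finset.sum_comm]
      rfl
    have hFs : ∀ A x, F (Fin.snoc A x : Fin (T + 1) → X) = F (Fin.snoc A x₀) :=
      fun A x => hF _ _ (hsnoc A x x₀ t)
    have hgs : ∀ A x, g t (Fin.snoc A x : Fin (T + 1) → X) = g t (Fin.snoc A x₀) :=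
      fun A x => hg t _ _ (hsnoc A x x₀ t)
    rw [hsum, hsum]
    simp only [key, hFs, hgs]
    induction t using Fin.lastCases with
    | last =>
      refine Finset.sum_congr rfl fun A _ => ?_
      simp only [Fin.snoc_last, mul_assoc, ← Finset.mul_sum]
      rw [← Finset.sum_mul, h1, one_mul]
    | cast t =>
      simp only [Fin.snoc_castSucc, ← Finset.sum_mul, ← Finset.mul_sum, h1, mul_one]
      refine ih (fun t A => g t.castSucc (Fin.snoc A x₀ : Fin (T + 1) → X))
        (fun t A A' h => hg _ _ _ fun s hs => ?_) (fun t A => h1 _ _) t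
        (fun A => F (Fin.snoc A x₀)) (fun A A' h => hF _ _ fun s hs => ?_)
      all_goals
        have hs' : s ≠ Fin.last T := (hs.trans_le (Fin.le_last _)).ne
        obtain ⟨s, rfl⟩ := Fin.exists_castSucc_eq.2 hs'
        simpa using h s (by simpa using hs)

/-! ### Products of distributions -/

section Pi

variable {N K : ℕ} {p : Fin N → Fin K → ℝ}

theorem sum_pi_mul_prod (f : Fin N → Fin K → ℝ) :
    ∑ x : Fin N → Fin K, (∏ i, p i (x i)) * ∏ i, f i (x i) = ∏ i, ∑ k, p i k * f i k := by
  simp only [← Finset.prod_mul_distrib]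
  rw [Finset.prod_univ_sum, Fintype.piFinset_univ]

theorem sum_pi_mul_apply (hp : ∀ i, ∑ k, p i k = 1) (i : Fin N) (f : Fin K → ℝ) :
    ∑ x : Fin N → Fin K, (∏ i, p i (x i)) * f (x i) = ∑ k, p i k * f k := by
  have h := sum_pi_mul_prod (p := p) (fun j => if j = i then f else 1)
  have e1 : ∀ x : Fin N → Fin K, ∏ j, (if j = i then f else 1) (x j) = f (x i) := by
    intro x
    rw [Finset.prod_eq_single i] <;> simp +contextual
  have e2 : ∏ j, ∑ k, p j k * (if j = i then f else 1) k = ∑ k, p i k * f k := by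
    rw [Finset.prod_eq_single i] <;> simp +contextual [hp]
  simp only [e1, e2] at h
  exact h

theorem sum_pi_mul_apply_mul_apply (hp : ∀ i, ∑ k, p i k = 1) {i j : Fin N} (hij : i ≠ j)
    (f g : Fin K → ℝ) : ∑ x : Fin N → Fin K, (∏ i, p i (x i)) * (f (x i) * g (x j)) =
      (∑ k, p i k * f k) * ∑ k, p j k * g k := by
  have h := sum_pi_mul_prod (p := p) (fun l => if l = i then f else if l = j then g else 1)
  have e1 : ∀ x : Fin N → Fin K,
      ∏ l, (if l = i then f else if l = j then g else 1) (x l) = f (x i) * g (x j) := by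
    intro x
    rw [Finset.prod_eq_mul i j hij] <;> simp +contextual [hij.symm]
  have e2 : ∏ l, ∑ k, p l k * (if l = i then f else if l = j then g else 1) k =
      (∑ k, p i k * f k) * ∑ k, p j k * g k := by
    rw [Finset.prod_eq_mul i j hij] <;> simp +contextual [hij.symm, hp]
  simp only [e1, e2] at h
  exact h

/-- The variances of independent centred random variables add up. -/
theorem sum_pi_mul_sq_sum (hp : ∀ i, ∑ k, p i k = 1) (f : Fin N → Fin K → ℝ)
    (hf : ∀ i, ∑ k, p i k * f i k = 0) :
    ∑ x : Fin N → Fin K, (∏ i, p i (x i)) * (∑ i, f i (x i)) ^ 2 =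
      ∑ i, ∑ k, p i k * f i k ^ 2 := by
  simp only [sq, Finset.sum_mul_sum]
  simp only [Finset.mul_sum]
  rw [Finset.sum_comm]
  refine Finset.sum_congr rfl fun i _ => ?_
  rw [Finset.sum_comm, Finset.sum_eq_single i]
  · exact sum_pi_mul_apply hp i fun k => f i k * f i k
  · intro j _ hj
    rw [sum_pi_mul_apply_mul_apply hp hj.symm, hf, zero_mul]
  · simp

end Pi

/-! ### Expectation over the trajectories. -/

namespace Setting

variable {N K d T : ℕ} {P : Setting N K d T}

section Expect

theorem expect_add (f g : (Fin T → Fin N → Fin K) → ℝ) :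
    P.expect (fun A => f A + g A) = P.expect f + P.expect g := by
  simp only [expect, mul_add, Finset.sum_add_distrib]

theorem expect_sub (f g : (Fin T → Fin N → Fin K) → ℝ) :
    P.expect (fun A => f A - g A) = P.expect f - P.expect g := by
  simp only [expect, mul_sub, Finset.sum_sub_distrib]

theorem expect_const_mul (c : ℝ) (f : (Fin T → Fin N → Fin K) → ℝ) :
    P.expect (fun A => c * f A) = c * P.expect f := by
  simp only [expect, Finset.mul_sum]
  exact Finset.sum_congr rfl fun A _ => by ring

theorem expect_sum {ι : Type*} (I : Finset ι) (f : ι → (Fin T → Fin N → Fin K) → ℝ) :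
    P.expect (fun A => ∑ i ∈ I, f i A) = ∑ i ∈ I, P.expect (f i) := by
  simp only [expect, Finset.mul_sum]
  exact Finset.sum_comm

theorem expect_const (hP : P.Admissible) (hd : 0 < d) (hK : 0 < K) (hT : 3 ≤ T) (c : ℝ) :
    P.expect (fun _ => c) = c := by
  rw [expect, ← Finset.sum_mul, sum_prob hP hd hK hT, one_mul]

theorem expect_mono (hP : P.Admissible) (hd : 0 < d) (hK : 0 < K) (hT : 3 ≤ T)
    {f g : (Fin T → Fin N → Fin K) → ℝ} (h : ∀ A, f A ≤ g A) : P.expect f ≤ P.expect g :=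
  Finset.sum_le_sum fun A _ => mul_le_mul_of_nonneg_left (h A) (prob_nonneg hP hd hK hT A)

theorem policy_congr_of_lt {A A' : Fin T → Fin N → Fin K} (t : Fin T)
    (h : ∀ s, s < t → A s = A' s) :
    P.policy A ((t : ℕ) / P.blockLen) = P.policy A' ((t : ℕ) / P.blockLen) := by
  refine P.policy_congr _ fun s hs => h s ?_
  by_contra hts
  exact absurd (Nat.div_le_div_right (c := P.blockLen) (Fin.le_def.1 (not_lt.1 hts)))
    (not_le.2 hs)

/-- Conditioning on the rounds before `t`: the joint action of round `t` may be averaged over the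
product of the current policies. -/
theorem expect_apply (hP : P.Admissible) (hd : 0 < d) (hK : 0 < K) (hT : 3 ≤ T) (t : Fin T)
    (F : (Fin T → Fin N → Fin K) → (Fin N → Fin K) → ℝ)
    (hF : ∀ A A', (∀ s, s < t → A s = A' s) → F A = F A') :
    P.expect (fun A => F A (A t)) = P.expect (fun A =>
      ∑ x : Fin N → Fin K, (∏ i, P.policy A ((t : ℕ) / P.blockLen) i (x i)) * F A x) := by
  have : Nonempty (Fin K) := ⟨⟨0, hK⟩⟩
  refine sum_prod_mul_eq T
    (fun t A x => ∏ i, P.policy A ((t : ℕ) / P.blockLen) i (x i)) (fun t A A' h => ?_) ?_ t F hF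
  · funext x
    rw [policy_congr_of_lt t h]
  · intro t A
    rw [← Fintype.piFinset_univ, ← Finset.prod_univ_sum]
    exact Finset.prod_eq_one fun i _ => (policy_mem hP hd hK hT A _ i).2

end Expect

end Setting

namespace Setting

variable {N K d T : ℕ} {P : Setting N K d T}

/-! ### Bounds on the parameters -/

theorem log_blockLen_pos (hP : P.Admissible) (hK : 2 ≤ K) (hT : 3 ≤ T) :
    0 < Real.log (((K : ℝ) * T) ^ 6 * √(14 * N)) := by
  have hN : (1 : ℝ) ≤ N := by exact_mod_cast hP.pos_agents
  have hK' : (2 : ℝ) ≤ K := by exact_mod_cast hK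
  have hT' : (3 : ℝ) ≤ T := by exact_mod_cast hT
  refine Real.log_pos ?_
  have h1 : 1 < ((K : ℝ) * T) ^ 6 := one_lt_pow₀ (by nlinarith) (by norm_num)
  have h2 : 1 ≤ √(14 * (N : ℝ)) := Real.one_le_sqrt.2 (by linarith)
  nlinarith

theorem blockLen_pos (hP : P.Admissible) (hK : 2 ≤ K) (hT : 3 ≤ T) : 0 < P.blockLen := by
  refine Nat.ceil_pos.2 (div_pos (log_blockLen_pos hP hK hT) (mul_pos ?_
    (Real.sqrt_pos.2 (by linarith [hP.sigma2_lt_one]))))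
  rw [sub_pos, div_lt_one (by positivity)]
  exact Real.lt_sqrt_of_sq_lt (by norm_num)

theorem eta_pos (hP : P.Admissible) (hd : 0 < d) (hK : 2 ≤ K) (hT : 3 ≤ T) : 0 < P.eta := by
  have hB : (0 : ℝ) < P.blockLen := by exact_mod_cast blockLen_pos hP hK hT
  have hd' : (0 : ℝ) < d := by exact_mod_cast hd
  have hT' : (0 : ℝ) < T := by exact_mod_cast (by omega : 0 < T)
  have hlog : 0 < Real.log K := Real.log_pos (by exact_mod_cast (by omega : 1 < K))
  exact lt_min (by positivity) (Real.sqrt_pos.2 (by positivity))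

theorem alpha_pos (hT : 3 ≤ T) : 0 < P.alpha := by
  have hT' : (0 : ℝ) < T := by exact_mod_cast (by omega : 0 < T)
  unfold alpha
  positivity

theorem beta_pos (hP : P.Admissible) (hd : 0 < d) (hK : 2 ≤ K) (hT : 3 ≤ T) : 0 < P.beta := by
  have hB : (0 : ℝ) < P.blockLen := by exact_mod_cast blockLen_pos hP hK hT
  have hd' : (0 : ℝ) < d := by exact_mod_cast hd
  have := eta_pos hP hd hK hT
  unfold beta
  positivity

/-- `T ≥ 3` gives `α ≤ 1/3`, and `η ≤ 1/(6Bd)` gives `β ≤ 1/2`. -/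
theorem one_sixth_le (hP : P.Admissible) (hd : 0 < d) (hK : 2 ≤ K) (hT : 3 ≤ T) :
    1 / 6 ≤ 1 - P.alpha - P.beta := by
  have hB : (0 : ℝ) < P.blockLen := by exact_mod_cast blockLen_pos hP hK hT
  have hd' : (0 : ℝ) < d := by exact_mod_cast hd
  have hT' : (3 : ℝ) ≤ T := by exact_mod_cast hT
  have h1 : P.alpha ≤ 1 / 3 := one_div_le_one_div_of_le (by norm_num) hT'
  have h2 : P.eta ≤ 1 / (6 * P.blockLen * d) := min_le_left _ _
  have h3 : P.beta ≤ 1 / 2 := by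
    rw [le_div_iff₀ (by positivity)] at h2
    unfold beta
    linarith
  linarith

/-! ### The policies -/

/-- The output of the base learner of agent `i` that is in charge of block `n`. -/
def base (P : Setting N K d T) (A : Fin T → Fin N → Fin K) (n : ℕ) (i : Fin N) : Fin K → ℝ :=
  P.baseOutput ((P.netState A n).feedback i (Fin.ofNat 2 n))

theorem policy_apply (A : Fin T → Fin N → Fin K) (n : ℕ) (i : Fin N) (k : Fin K) :
    P.policy A n i k = (1 - P.alpha - P.beta) * P.base A n i k
      + (P.alpha / K + P.beta / P.S.card * (if k ∈ P.S then 1 else 0)) := by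
  rw [policy, blockPolicy, base, add_assoc]

theorem base_mem (hK : 2 ≤ K) (A : Fin T → Fin N → Fin K) (n : ℕ) (i : Fin N) :
    P.base A n i ∈ stdSimplex ℝ (Fin K) :=
  P.baseOutput_mem (by omega) _

theorem mixing_nonneg (hP : P.Admissible) (hd : 0 < d) (hK : 2 ≤ K) (hT : 3 ≤ T) (k : Fin K) :
    0 ≤ P.beta / P.S.card * (if k ∈ P.S then 1 else 0) := by
  have := beta_pos hP hd hK hT
  split <;> positivity

theorem policy_pos (hP : P.Admissible) (hd : 0 < d) (hK : 2 ≤ K) (hT : 3 ≤ T)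
    (A : Fin T → Fin N → Fin K) (n : ℕ) (i : Fin N) (k : Fin K) : 0 < P.policy A n i k := by
  have h1 := (base_mem (P := P) hK A n i).1 k
  have h2 := one_sixth_le hP hd hK hT
  have hK' : (0 : ℝ) < K := by exact_mod_cast (by omega : 0 < K)
  have h3 : 0 < P.alpha / K := div_pos (alpha_pos hT) hK'
  have h4 := mixing_nonneg hP hd hK hT k
  have h5 : 0 ≤ (1 - P.alpha - P.beta) * P.base A n i k := mul_nonneg (by linarith) h1
  rw [policy_apply]
  linarith

theorem base_le_mul_policy (hP : P.Admissible) (hd : 0 < d) (hK : 2 ≤ K) (hT : 3 ≤ T)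
    (A : Fin T → Fin N → Fin K) (n : ℕ) (i : Fin N) (k : Fin K) :
    P.base A n i k ≤ 6 * P.policy A n i k := by
  have h1 := (base_mem (P := P) hK A n i).1 k
  have h2 := one_sixth_le hP hd hK hT
  have h3 : 0 ≤ P.alpha / K := div_nonneg (alpha_pos hT).le (by positivity)
  have h4 := mixing_nonneg hP hd hK hT k
  have h5 := mul_le_mul_of_nonneg_right h2 h1
  rw [policy_apply]
  linarith

/-- The purpose of `β = 3Bdη`: as `|S| ≤ 3d`, each spanner action gets weight at least `Bη`. Single
estimates are then at most `1/(Bη)` and block sums at most `1/η`. -/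
theorem blockLen_mul_eta_le_policy (hP : P.Admissible) (hd : 0 < d) (hK : 2 ≤ K) (hT : 3 ≤ T)
    (A : Fin T → Fin N → Fin K) (n : ℕ) (i : Fin N) {k : Fin K} (hk : k ∈ P.S) :
    P.blockLen * P.eta ≤ P.policy A n i k := by
  have h1 := (base_mem (P := P) hK A n i).1 k
  have h2 := one_sixth_le hP hd hK hT
  have h3 : 0 ≤ P.alpha / K := div_nonneg (alpha_pos hT).le (by positivity)
  have h5 : 0 ≤ (1 - P.alpha - P.beta) * P.base A n i k := mul_nonneg (by linarith) h1
  have h6 : (0 : ℝ) < P.S.card := by exact_mod_cast hP.card_pos hd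
  have h7 : (P.S.card : ℝ) ≤ 3 * d := by exact_mod_cast hP.card_le
  have h8 : P.blockLen * P.eta ≤ P.beta / P.S.card := by
    rw [le_div_iff₀ h6]
    have h9 : 0 ≤ (P.blockLen : ℝ) * P.eta := mul_nonneg (by positivity) P.eta_nonneg
    calc P.blockLen * P.eta * P.S.card ≤ P.blockLen * P.eta * (3 * d) := by gcongr
      _ = P.beta := by unfold beta; ring
  rw [policy_apply, if_pos hk, mul_one]
  linarith

theorem abs_avgLoss_le (hP : P.Admissible) (t : Fin T) (k : Fin K) : |P.avgLoss t k| ≤ 1 := by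
  have hN : (0 : ℝ) < N := by exact_mod_cast hP.pos_agents
  rw [avgLoss, abs_mul, abs_of_nonneg (by positivity), one_div, inv_mul_le_iff₀ hN, mul_one]
  refine (Finset.abs_sum_le_sum_abs _ _).trans ?_
  refine (Finset.sum_le_card_nsmul _ _ 1 fun j _ => abs_le.2 (hP.loss_mem t j k)).trans ?_
  simp

/-- Exploration replaces a fraction `α + β` of the base distribution, and two losses differ by at
most 2. -/
theorem sum_policy_mul_avgLoss_le (hP : P.Admissible) (hd : 0 < d) (hK : 2 ≤ K) (hT : 3 ≤ T)
    (A : Fin T → Fin N → Fin K) (n : ℕ) (i : Fin N) (t : Fin T) :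
    ∑ k, P.policy A n i k * P.avgLoss t k ≤
      ∑ k, P.base A n i k * P.avgLoss t k + 2 * (P.alpha + P.beta) := by
  have hα := alpha_pos (P := P) hT
  have hβ := beta_pos hP hd hK hT
  have hp := (policy_mem hP hd (by omega) hT A n i).2
  have hb := (base_mem (P := P) hK A n i).2
  have h1 : ∀ k, P.policy A n i k * P.avgLoss t k ≤ P.base A n i k * P.avgLoss t k
      + (P.policy A n i k - P.base A n i k + 2 * (P.alpha + P.beta) * P.base A n i k) := by
    intro k
    obtain ⟨h2, h3⟩ := abs_le.1 (abs_avgLoss_le hP t k)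
    have h4 := (base_mem (P := P) hK A n i).1 k
    have h5 : 0 ≤ P.policy A n i k - (1 - P.alpha - P.beta) * P.base A n i k := by
      have := mixing_nonneg hP hd hK hT k
      have h6 : 0 ≤ P.alpha / K := div_nonneg hα.le (by positivity)
      rw [policy_apply]
      linarith
    nlinarith [mul_nonneg h5 (sub_nonneg.2 h3),
      mul_nonneg (mul_nonneg (add_pos hα hβ).le h4) (by linarith : 0 ≤ 1 + P.avgLoss t k)]
  refine (Finset.sum_le_sum fun k _ => h1 k).trans ?_
  rw [Finset.sum_add_distrib, Finset.sum_add_distrib, Finset.sum_sub_distrib, ← Finset.mul_sum,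
    hp, hb]
  linarith

/-! ### The feedback of the base learners -/

/-- The reconstructed losses of block `n` that agent `i` obtains by gossip. -/
def fed (P : Setting N K d T) (A : Fin T → Fin N → Fin K) (n : ℕ) (i : Fin N) : Fin K → ℝ :=
  P.reconstruct (P.gossip (P.netState A (n + 1)).start P.blockLen i)

/-- The rounds of block `n`. -/
def block (P : Setting N K d T) (n : ℕ) : Finset (Fin T) :=
  Finset.univ.filter fun t : Fin T => (t : ℕ) / P.blockLen = n

/-- The network average of the loss estimates of round `t`. -/
def roundEst (P : Setting N K d T) (A : Fin T → Fin N → Fin K) (t : Fin T) (k : Fin K) : ℝ :=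
  1 / N * ∑ j, P.actEst (P.policy A ((t : ℕ) / P.blockLen) j) t j (A t j) k

/-- The network average of the loss estimates of block `n`. -/
def blockEst (P : Setting N K d T) (A : Fin T → Fin N → Fin K) (n : ℕ) (k : Fin K) : ℝ :=
  ∑ t ∈ P.block n, P.roundEst A t k

/-- At the start of block `n` the gossip on block `n - 1` has yet to run, hence the range `n - 1`;
truncated subtraction covers `n = 0`. -/
theorem sum_feedback (A : Fin T → Fin N → Fin K) (i : Fin N) (c : Fin 2) (n : ℕ) :
    (((P.netState A n).feedback i c).map P.reconstruct).sum =
      ∑ m ∈ Finset.range (n - 1) with m % 2 = (c : ℕ), P.fed A m i := by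
  induction n with
  | zero => simp [netState]
  | succ n ih =>
    rcases n with _ | m
    · simp [netState, blockStep]
    · rw [netState, blockStep]
      simp only [Nat.add_sub_cancel, Nat.add_eq_zero_iff, one_ne_zero, and_false, if_false] at ih ⊢
      rw [Finset.range_add_one, Finset.filter_insert]
      by_cases hc : m % 2 = (c : ℕ)
      · have hc' : c = Fin.ofNat 2 m := Fin.ext hc.symm
        rw [if_pos hc, Finset.sum_insert (by simp), ← ih, hc', Function.update_self]
        simp [fed, add_comm]
      · have hc' : c ≠ Fin.ofNat 2 m := fun h => hc (by rw [h]; rfl)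
        rw [if_neg hc, Function.update_of_ne hc', ih]

/-- The only missing feedback, from block `n - 1`, has the wrong parity and belongs to the other
copy. So the delay is invisible and the range extends to `n`. -/
theorem base_eq (hP : P.Admissible) (hd : 0 < d) (hK : 2 ≤ K) (hT : 3 ≤ T)
    (A : Fin T → Fin N → Fin K) (n : ℕ) (i : Fin N) : P.base A n i =
      expWeights P.eta (∑ l ∈ Finset.range n with l % 2 = n % 2, P.fed A l i) := by
  have h1 := sum_feedback (P := P) A i (Fin.ofNat 2 n) n
  have h2 : (Finset.range (n - 1)).filter (fun m => m % 2 = ((Fin.ofNat 2 n : Fin 2) : ℕ)) =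
      (Finset.range n).filter (fun m => m % 2 = n % 2) := by
    ext m
    simp only [Finset.mem_filter, Finset.mem_range, Fin.val_ofNat]
    omega
  rw [h2] at h1
  rw [← h1, base, baseOutput]
  split
  · next h => rw [h]; exact expWeights_zero.symm
  · exact ftrlArgmin_eq (by omega) (eta_pos hP hd hK hT) _

theorem card_block_le (hP : P.Admissible) (hK : 2 ≤ K) (hT : 3 ≤ T) (n : ℕ) :
    (P.block n).card ≤ P.blockLen := by
  have hB := blockLen_pos hP hK hT
  calc (P.block n).card = ((P.block n).map Fin.valEmbedding).card := (Finset.card_map _).symm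
    _ ≤ (Finset.Ico (n * P.blockLen) ((n + 1) * P.blockLen)).card := by
      refine Finset.card_le_card fun s hs => ?_
      obtain ⟨t, ht, rfl⟩ := Finset.mem_map.1 hs
      have h := (Finset.mem_filter.1 ht).2
      rw [Nat.div_eq_iff hB] at h
      rw [Finset.mem_Ico, add_one_mul]
      simp only [Fin.valEmbedding_apply]
      omega
    _ = P.blockLen := by rw [Nat.card_Ico, add_one_mul]; omega

theorem abs_sum_block_le (hP : P.Admissible) (hd : 0 < d) (hK : 2 ≤ K) (hT : 3 ≤ T) (n : ℕ)
    {f : Fin T → ℝ} (hf : ∀ t, |f t| ≤ 1 / (P.blockLen * P.eta)) :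
    |∑ t ∈ P.block n, f t| ≤ 1 / P.eta := by
  have hB : (0 : ℝ) < P.blockLen := by exact_mod_cast blockLen_pos hP hK hT
  have hη := eta_pos hP hd hK hT
  refine (Finset.abs_sum_le_sum_abs _ _).trans ?_
  refine (Finset.sum_le_card_nsmul _ _ _ fun t _ => hf t).trans ?_
  have h : ((P.block n).card : ℝ) ≤ P.blockLen := by exact_mod_cast card_block_le hP hK hT n
  rw [nsmul_eq_mul]
  calc ((P.block n).card : ℝ) * (1 / (P.blockLen * P.eta)) ≤
      P.blockLen * (1 / (P.blockLen * P.eta)) := by gcongr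
    _ = 1 / P.eta := by field_simp

theorem abs_actEst_policy_le (hP : P.Admissible) (hd : 0 < d) (hK : 2 ≤ K) (hT : 3 ≤ T)
    (A : Fin T → Fin N → Fin K) (n : ℕ) (t : Fin T) (i : Fin N) (m k : Fin K) :
    |P.actEst (P.policy A n i) t i m k| ≤ 1 / (P.blockLen * P.eta) := by
  have hB : (0 : ℝ) < P.blockLen := by exact_mod_cast blockLen_pos hP hK hT
  have hη := eta_pos hP hd hK hT
  exact abs_actEst_le hP (policy_pos hP hd hK hT A n i) (by positivity)
    (fun k hk => blockLen_mul_eta_le_policy hP hd hK hT A n i hk) t i m k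

theorem start_eq (A : Fin T → Fin N → Fin K) (n : ℕ) (i : Fin N) :
    (P.netState A (n + 1)).start i =
      ∑ t ∈ P.block n, P.lossEst (P.policy A n i) t i (A t i) := rfl

theorem abs_start_le (hP : P.Admissible) (hd : 0 < d) (hK : 2 ≤ K) (hT : 3 ≤ T)
    (A : Fin T → Fin N → Fin K) (n : ℕ) (i : Fin N) (s : P.S) :
    |(P.netState A (n + 1)).start i s| ≤ 1 / P.eta := by
  rw [start_eq, Finset.sum_apply]
  refine abs_sum_block_le hP hd hK hT n fun t => ?_
  rw [lossEst_apply]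
  exact abs_actEst_policy_le hP hd hK hT A n t i _ _

/-- Reconstruction is linear, so it commutes with summing over the block and averaging over the
agents. This identifies the target of the gossip. -/
theorem blockEst_eq (hP : P.Admissible) (A : Fin T → Fin N → Fin K) (n : ℕ) (k : Fin K) :
    P.blockEst A n k =
      P.reconstruct (fun s => 1 / N * ∑ j, (P.netState A (n + 1)).start j s) k := by
  have h1 : P.reconstruct (fun s => 1 / N * ∑ j, (P.netState A (n + 1)).start j s) k =
      1 / N * ∑ j, P.reconstruct ((P.netState A (n + 1)).start j) k := by
    simp only [reconstruct, Finset.mul_sum]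
    rw [Finset.sum_comm]
    exact Finset.sum_congr rfl fun j _ => Finset.sum_congr rfl fun s _ => by ring
  rw [h1, blockEst]
  simp only [roundEst, ← Finset.mul_sum, start_eq, reconstruct_sum, Finset.sum_apply,
    reconstruct_lossEst hP]
  rw [Finset.sum_comm]
  congr 1
  refine Finset.sum_congr rfl fun j _ => Finset.sum_congr rfl fun t ht => ?_
  rw [(Finset.mem_filter.1 ht).2]

theorem abs_blockEst_le (hP : P.Admissible) (hd : 0 < d) (hK : 2 ≤ K) (hT : 3 ≤ T)
    (A : Fin T → Fin N → Fin K) (n : ℕ) (k : Fin K) : |P.blockEst A n k| ≤ 1 / P.eta := by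
  have hN : (0 : ℝ) < N := by exact_mod_cast hP.pos_agents
  refine abs_sum_block_le hP hd hK hT n fun t => ?_
  rw [roundEst, abs_mul, abs_of_nonneg (by positivity), one_div, inv_mul_le_iff₀ hN]
  refine (Finset.abs_sum_le_sum_abs _ _).trans ?_
  refine (Finset.sum_le_card_nsmul _ _ _ fun j _ =>
    abs_actEst_policy_le hP hd hK hT A _ t j _ _).trans ?_
  simp

/-- Gossip reproduces the network averages up to a negligible error. -/
theorem abs_fed_sub_blockEst_le (hP : P.Admissible) (hd : 0 < d) (hK : 2 ≤ K) (hT : 3 ≤ T)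
    (hB : P.blockLen < T) (A : Fin T → Fin N → Fin K) (n : ℕ) (i : Fin N) (k : Fin K) :
    |P.fed A n i k - P.blockEst A n k| ≤ 1 / (P.eta * T ^ 2) := by
  have hK' : (0 : ℝ) < K := by exact_mod_cast (by omega : 0 < K)
  have hη := eta_pos hP hd hK hT
  have hT' : (0 : ℝ) < T := by exact_mod_cast (by omega : 0 < T)
  rw [blockEst_eq hP, fed, reconstruct, reconstruct, ← Finset.sum_sub_distrib]
  have h1 : ∀ s : P.S, |P.lam k s| ≤ 1 := by
    intro s
    have h2 := (hP.spanner k).2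
    rw [Real.sqrt_le_one] at h2
    rw [← sq_le_one_iff_abs_le_one]
    exact (Finset.single_le_sum (f := fun s => P.lam k s ^ 2) (fun _ _ => sq_nonneg _)
      (Finset.mem_univ s)).trans h2
  have h3 : ∀ s : P.S, |P.lam k s * P.gossip (P.netState A (n + 1)).start P.blockLen i s -
      P.lam k s * (1 / N * ∑ j, (P.netState A (n + 1)).start j s)| ≤ 1 / P.eta / (K * T ^ 2) := by
    intro s
    rw [← mul_sub, abs_mul]
    refine (mul_le_of_le_one_left (abs_nonneg _) (h1 s)).trans ?_
    exact abs_gossip_sub_le hP (by omega) hT hB (abs_start_le hP hd hK hT A n) i s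
  refine (Finset.abs_sum_le_sum_abs _ _).trans ?_
  refine (Finset.sum_le_card_nsmul _ _ _ fun s _ => h3 s).trans ?_
  -- The factor `1/K` in the gossip error pays for the sum over the spanner.
  have h4 : (P.S.card : ℝ) ≤ K := by
    exact_mod_cast (Finset.card_le_univ P.S).trans_eq (Fintype.card_fin K)
  rw [nsmul_eq_mul, Finset.card_univ, Fintype.card_coe]
  calc (P.S.card : ℝ) * (1 / P.eta / (K * T ^ 2)) ≤ K * (1 / P.eta / (K * T ^ 2)) := by gcongr
    _ = _ := by field_simp

theorem abs_eta_mul_fed_le (hP : P.Admissible) (hd : 0 < d) (hK : 2 ≤ K) (hT : 3 ≤ T)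
    (hB : P.blockLen < T) (A : Fin T → Fin N → Fin K) (n : ℕ) (i : Fin N) (k : Fin K) :
    |P.eta * P.fed A n i k| ≤ 2 := by
  have hη := eta_pos hP hd hK hT
  have hT' : (1 : ℝ) ≤ T := by exact_mod_cast (by omega : 1 ≤ T)
  have h1 := abs_fed_sub_blockEst_le hP hd hK hT hB A n i k
  have h2 := abs_blockEst_le hP hd hK hT A n k
  have h3 : 1 / (P.eta * T ^ 2) ≤ 1 / P.eta := by
    refine one_div_le_one_div_of_le hη ?_
    exact le_mul_of_one_le_right hη.le (one_le_pow₀ hT')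
  have h4 : |P.fed A n i k| ≤ 2 / P.eta := by
    have := abs_add_le (P.fed A n i k - P.blockEst A n k) (P.blockEst A n k)
    rw [sub_add_cancel] at this
    calc _ ≤ _ := this
      _ ≤ 1 / P.eta + 1 / P.eta := by linarith
      _ = _ := by ring
  rw [abs_mul, abs_of_pos hη]
  calc _ ≤ P.eta * (2 / P.eta) := by gcongr
    _ = 2 := by field_simp

/-- The policies of the agents are multiplicatively close to each other. -/
theorem policy_le_mul_policy (hP : P.Admissible) (hd : 0 < d) (hK : 2 ≤ K) (hT : 3 ≤ T)
    (hB : P.blockLen < T) (A : Fin T → Fin N → Fin K) {n : ℕ} (hn : n ≤ T) (i j : Fin N)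
    (k : Fin K) : P.policy A n i k ≤ 8 * P.policy A n j k := by
  have hη := eta_pos hP hd hK hT
  have hT' : (3 : ℝ) ≤ T := by exact_mod_cast hT
  have h1 : P.base A n i k ≤ 8 * P.base A n j k := by
    have hD : ∀ k, |(∑ l ∈ Finset.range n with l % 2 = n % 2, P.fed A l i) k -
        (∑ l ∈ Finset.range n with l % 2 = n % 2, P.fed A l j) k| ≤ 2 / (P.eta * T) := by
      intro k
      rw [Finset.sum_apply, Finset.sum_apply, ← Finset.sum_sub_distrib]
      have h2 : ∀ l, |P.fed A l i k - P.fed A l j k| ≤ 2 / (P.eta * T ^ 2) := by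
        intro l
        have h3 := abs_fed_sub_blockEst_le hP hd hK hT hB A l i k
        have h4 := abs_fed_sub_blockEst_le hP hd hK hT hB A l j k
        rw [abs_sub_comm] at h4
        have h5 := abs_sub_le (P.fed A l i k) (P.blockEst A l k) (P.fed A l j k)
        calc _ ≤ _ := h5
          _ ≤ 1 / (P.eta * T ^ 2) + 1 / (P.eta * T ^ 2) := by linarith
          _ = _ := by ring
      refine (Finset.abs_sum_le_sum_abs _ _).trans ?_
      refine (Finset.sum_le_card_nsmul _ _ _ fun l _ => h2 l).trans ?_
      have h6 : (((Finset.range n).filter fun l => l % 2 = n % 2).card : ℝ) ≤ T := by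
        exact_mod_cast (Finset.card_filter_le _ _).trans (by simpa using hn)
      rw [nsmul_eq_mul]
      calc _ ≤ (T : ℝ) * (2 / (P.eta * T ^ 2)) := by gcongr
        _ = _ := by field_simp
    have h7 := expWeights_le_exp_mul (by omega) hη.le hD k
    rw [← base_eq hP hd hK hT, ← base_eq hP hd hK hT] at h7
    -- The exponent is `4/T ≤ 2`, and `e² < 8`.
    have h8 : Real.exp (2 * (P.eta * (2 / (P.eta * T)))) ≤ 8 := by
      have e : 2 * (P.eta * (2 / (P.eta * T))) = 4 / T := by field_simp; norm_num
      have h9 : (4 : ℝ) / T ≤ 2 * 1 := by rw [div_le_iff₀ (by linarith)]; linarith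
      rw [e]
      calc Real.exp (4 / T) ≤ Real.exp ((2 : ℕ) * 1) := Real.exp_le_exp.2 (by exact_mod_cast h9)
        _ = Real.exp 1 ^ 2 := Real.exp_nat_mul _ _
        _ ≤ 2.7182818286 ^ 2 := by gcongr; exact Real.exp_one_lt_d9.le
        _ ≤ 8 := by norm_num
    exact h7.trans (mul_le_mul_of_nonneg_right h8 ((base_mem hK A n j).1 k))
  have h2 := one_sixth_le hP hd hK hT
  have h3 : 0 ≤ P.alpha / K := div_nonneg (alpha_pos hT).le (by positivity)
  have h4 := mixing_nonneg hP hd hK hT k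
  have h5 := mul_le_mul_of_nonneg_left h1 (by linarith : 0 ≤ 1 - P.alpha - P.beta)
  rw [policy_apply, policy_apply]
  linarith

end Setting

namespace Setting

variable {N K d T : ℕ} {P : Setting N K d T}

/-! ### Moments of the loss estimates -/

/-- The error of the network average of the loss estimates of round `t`. -/
def roundErr (P : Setting N K d T) (A : Fin T → Fin N → Fin K) (t : Fin T) (k : Fin K) : ℝ :=
  P.roundEst A t k - P.avgLoss t k

/-- The error that agent `j` contributes in round `t` by playing `m`. -/
def agentErr (P : Setting N K d T) (A : Fin T → Fin N → Fin K) (t : Fin T) (k : Fin K)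
    (j : Fin N) (m : Fin K) : ℝ :=
  P.actEst (P.policy A ((t : ℕ) / P.blockLen) j) t j m k - P.loss t j k

theorem roundErr_eq (A : Fin T → Fin N → Fin K) (t : Fin T) (k : Fin K) :
    P.roundErr A t k = 1 / N * ∑ j, P.agentErr A t k j (A t j) := by
  simp only [roundErr, roundEst, avgLoss, agentErr, Finset.sum_sub_distrib, mul_sub]

theorem agentErr_congr {A A' : Fin T → Fin N → Fin K} (t : Fin T)
    (h : ∀ s, s < t → A s = A' s) : P.agentErr A t = P.agentErr A' t := by
  funext k j m
  rw [agentErr, agentErr, policy_congr_of_lt t h]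

theorem roundErr_congr {A A' : Fin T → Fin N → Fin K} (t : Fin T)
    (h : ∀ s, s ≤ t → A s = A' s) : P.roundErr A t = P.roundErr A' t := by
  funext k
  rw [roundErr_eq, roundErr_eq, agentErr_congr t fun s hs => h s hs.le, h t le_rfl]

theorem sum_policy_mul_agentErr (hP : P.Admissible) (hd : 0 < d) (hK : 2 ≤ K) (hT : 3 ≤ T)
    (A : Fin T → Fin N → Fin K) (t : Fin T) (k : Fin K) (j : Fin N) :
    ∑ m, P.policy A ((t : ℕ) / P.blockLen) j m * P.agentErr A t k j m = 0 := by
  simp only [agentErr, mul_sub, Finset.sum_sub_distrib, ← Finset.sum_mul]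
  rw [sum_mul_actEst hP (policy_pos hP hd hK hT A _ j),
    (policy_mem hP hd (by omega) hT A _ j).2, one_mul, sub_self]

theorem sum_policy_mul_agentErr_sq_le (hP : P.Admissible) (hd : 0 < d) (hK : 2 ≤ K) (hT : 3 ≤ T)
    (A : Fin T → Fin N → Fin K) (t : Fin T) (k : Fin K) (j : Fin N) :
    ∑ m, P.policy A ((t : ℕ) / P.blockLen) j m * P.agentErr A t k j m ^ 2 ≤
      P.a k ⬝ᵥ (P.corrMatrix (P.policy A ((t : ℕ) / P.blockLen) j))⁻¹.mulVec (P.a k) := by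
  set p := P.policy A ((t : ℕ) / P.blockLen) j with hp
  have hpos : ∀ k, 0 < p k := policy_pos hP hd hK hT A _ j
  have h1 : ∑ m, p m * P.agentErr A t k j m ^ 2 =
      ∑ m, p m * P.actEst p t j m k ^ 2 - P.loss t j k ^ 2 := by
    have h2 := sum_mul_actEst hP hpos t j k
    have h3 : ∑ m, p m = 1 := (policy_mem hP hd (by omega) hT A _ j).2
    calc _ = ∑ m, (p m * P.actEst p t j m k ^ 2 - 2 * P.loss t j k * (p m * P.actEst p t j m k)
          + p m * P.loss t j k ^ 2) :=
          Finset.sum_congr rfl fun m _ => by rw [agentErr, ← hp]; ring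
      _ = _ := by
        rw [Finset.sum_add_distrib, Finset.sum_sub_distrib, ← Finset.mul_sum, ← Finset.sum_mul,
          h2, h3]
        ring
  rw [h1]
  linarith [sum_mul_actEst_sq_le hP hpos t j k, sq_nonneg (P.loss t j k)]

/-- Unbiasedness given the past: the errors are martingale differences, hence orthogonal to any
weight fixed before round `t`. -/
theorem expect_mul_roundErr (hP : P.Admissible) (hd : 0 < d) (hK : 2 ≤ K) (hT : 3 ≤ T)
    (t : Fin T) (k : Fin K) {w : (Fin T → Fin N → Fin K) → ℝ}
    (hw : ∀ A A', (∀ s, s < t → A s = A' s) → w A = w A') :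
    P.expect (fun A => w A * P.roundErr A t k) = 0 := by
  have h := expect_apply hP hd (by omega) hT t
    (fun A x => w A * (1 / N * ∑ j, P.agentErr A t k j (x j)))
    (fun A A' hA => by rw [hw A A' hA, agentErr_congr t hA])
  simp only [roundErr_eq]
  rw [h]
  have h0 : ∀ A, ∑ x : Fin N → Fin K, (∏ i, P.policy A ((t : ℕ) / P.blockLen) i (x i)) *
      (w A * (1 / N * ∑ j, P.agentErr A t k j (x j))) = 0 := by
    intro A
    calc _ = w A * (1 / N) * ∑ j, ∑ x : Fin N → Fin K,
          (∏ i, P.policy A ((t : ℕ) / P.blockLen) i (x i)) * P.agentErr A t k j (x j) := by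
          rw [Finset.sum_comm]
          simp only [Finset.mul_sum]
          exact Finset.sum_congr rfl fun x _ => Finset.sum_congr rfl fun j _ => by ring
      _ = 0 := by
          rw [Finset.sum_eq_zero, mul_zero]
          intro j _
          rw [sum_pi_mul_apply (fun i => (policy_mem hP hd (by omega) hT A _ i).2),
            sum_policy_mul_agentErr hP hd hK hT]
  simp only [h0]
  exact expect_const hP hd (by omega) hT 0

/-- Given the past the agents are independent, so the variances of their errors add. The prefactor
`1/N²` against `N` summands is the source of the `1/N` in the regret. -/
theorem expect_mul_roundErr_sq_le (hP : P.Admissible) (hd : 0 < d) (hK : 2 ≤ K) (hT : 3 ≤ T)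
    (t : Fin T) (k : Fin K) {w : (Fin T → Fin N → Fin K) → ℝ} (hw0 : ∀ A, 0 ≤ w A)
    (hw : ∀ A A', (∀ s, s < t → A s = A' s) → w A = w A') :
    P.expect (fun A => w A * P.roundErr A t k ^ 2) ≤ P.expect (fun A => w A * (1 / N ^ 2 *
      ∑ j, P.a k ⬝ᵥ
        (P.corrMatrix (P.policy A ((t : ℕ) / P.blockLen) j))⁻¹.mulVec (P.a k))) := by
  have h := expect_apply hP hd (by omega) hT t
    (fun A x => w A * (1 / N * ∑ j, P.agentErr A t k j (x j)) ^ 2)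
    (fun A A' hA => by rw [hw A A' hA, agentErr_congr t hA])
  simp only [roundErr_eq]
  rw [h]
  refine expect_mono hP hd (by omega) hT fun A => ?_
  calc _ = w A * (1 / N ^ 2 * ∑ x : Fin N → Fin K,
        (∏ i, P.policy A ((t : ℕ) / P.blockLen) i (x i)) *
          (∑ j, P.agentErr A t k j (x j)) ^ 2) := by
        rw [Finset.mul_sum, Finset.mul_sum]
        exact Finset.sum_congr rfl fun x _ => by ring
    _ ≤ _ := by
        rw [sum_pi_mul_sq_sum (fun i => (policy_mem hP hd (by omega) hT A _ i).2) _
          (sum_policy_mul_agentErr hP hd hK hT A t k)]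
        refine mul_le_mul_of_nonneg_left ?_ (hw0 A)
        refine mul_le_mul_of_nonneg_left ?_ (by positivity)
        exact Finset.sum_le_sum fun j _ => sum_policy_mul_agentErr_sq_le hP hd hK hT A t k j

theorem lt_of_mem_block {n : ℕ} {s t : Fin T} (ht : t ∈ P.block n)
    (hs : (s : ℕ) / P.blockLen < n) : s < t := by
  rw [← (Finset.mem_filter.1 ht).2] at hs
  by_contra hts
  exact absurd (Nat.div_le_div_right (c := P.blockLen) (Fin.le_def.1 (not_lt.1 hts)))
    (not_le.2 hs)

/-- The errors of different rounds of a block are uncorrelated. -/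
theorem expect_mul_sq_sum_roundErr (hP : P.Admissible) (hd : 0 < d) (hK : 2 ≤ K) (hT : 3 ≤ T)
    (n : ℕ) (k : Fin K) {w : (Fin T → Fin N → Fin K) → ℝ}
    (hw : ∀ A A', (∀ s : Fin T, (s : ℕ) / P.blockLen < n → A s = A' s) → w A = w A') :
    P.expect (fun A => w A * (∑ t ∈ P.block n, P.roundErr A t k) ^ 2) =
      ∑ t ∈ P.block n, P.expect (fun A => w A * P.roundErr A t k ^ 2) := by
  have hcross : ∀ s ∈ P.block n, ∀ t ∈ P.block n, s < t →
      P.expect (fun A => w A * P.roundErr A s k * P.roundErr A t k) = 0 := by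
    intro s _ t ht hst
    refine expect_mul_roundErr hP hd hK hT t k fun A A' h => ?_
    rw [hw A A' fun u hu => h u (lt_of_mem_block ht hu),
      roundErr_congr s fun u hu => h u (hu.trans_lt hst)]
  have h1 : ∀ A, w A * (∑ t ∈ P.block n, P.roundErr A t k) ^ 2 =
      ∑ s ∈ P.block n, ∑ t ∈ P.block n, w A * P.roundErr A s k * P.roundErr A t k := by
    intro A
    rw [sq, Finset.sum_mul_sum, Finset.mul_sum]
    refine Finset.sum_congr rfl fun s _ => ?_
    rw [Finset.mul_sum]
    exact Finset.sum_congr rfl fun t _ => by ring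
  simp only [h1]
  rw [expect_sum]
  refine Finset.sum_congr rfl fun s hs => ?_
  rw [expect_sum, Finset.sum_eq_single s]
  · simp only [sq, mul_assoc]
  · intro t ht hts
    rcases lt_or_gt_of_ne hts with h | h
    · rw [← hcross t ht s hs h]
      congr 1
      funext A
      ring
    · exact hcross s hs t ht h
  · exact fun h => absurd hs h

theorem base_congr {A A' : Fin T → Fin N → Fin K} (n : ℕ)
    (h : ∀ t : Fin T, (t : ℕ) / P.blockLen < n → A t = A' t) : P.base A n = P.base A' n := by
  funext i
  rw [base, base, P.netState_congr n h]

/-- The weights of agent `i` meet the correlation matrix of agent `j`. Since `base i ≤ 6 policy i ≤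
48 policy j`, the trace identity bounds each agent's term by `48 d`. -/
theorem expect_base_mul_sq_sum_roundErr_le (hP : P.Admissible) (hd : 0 < d) (hK : 2 ≤ K)
    (hT : 3 ≤ T) (hB : P.blockLen < T) (i : Fin N) (n : ℕ) :
    P.expect (fun A => ∑ k, P.base A n i k * (∑ t ∈ P.block n, P.roundErr A t k) ^ 2) ≤
      (P.block n).card * (48 * d / N) := by
  have hN : (0 : ℝ) < N := by exact_mod_cast hP.pos_agents
  rw [expect_sum]
  have h1 : ∀ k, P.expect (fun A => P.base A n i k * (∑ t ∈ P.block n, P.roundErr A t k) ^ 2) ≤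
      ∑ t ∈ P.block n, P.expect (fun A => P.base A n i k * (1 / N ^ 2 * ∑ j, P.a k ⬝ᵥ
        (P.corrMatrix (P.policy A ((t : ℕ) / P.blockLen) j))⁻¹.mulVec (P.a k))) := by
    intro k
    have hw : ∀ A A', (∀ s : Fin T, (s : ℕ) / P.blockLen < n → A s = A' s) →
        P.base A n i k = P.base A' n i k := fun A A' h => by rw [base_congr n h]
    rw [expect_mul_sq_sum_roundErr hP hd hK hT n k hw]
    refine Finset.sum_le_sum fun t ht => ?_
    exact expect_mul_roundErr_sq_le hP hd hK hT t k (fun A => (base_mem hK A n i).1 k)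
      fun A A' h => hw A A' fun s hs => h s (lt_of_mem_block ht hs)
  refine (Finset.sum_le_sum fun k _ => h1 k).trans ?_
  rw [Finset.sum_comm]
  refine (Finset.sum_le_card_nsmul _ _ (48 * d / N : ℝ) fun t ht => ?_).trans_eq
    (nsmul_eq_mul _ _)
  rw [← expect_sum, ← expect_const hP hd (by omega) hT (48 * d / N : ℝ)]
  refine expect_mono hP hd (by omega) hT fun A => ?_
  have htn : (t : ℕ) / P.blockLen ≤ T := (Nat.div_le_self _ _).trans t.2.le
  rw [(Finset.mem_filter.1 ht).2] at htn ⊢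
  calc _ = 1 / N ^ 2 * ∑ j, ∑ k, P.base A n i k *
        (P.a k ⬝ᵥ (P.corrMatrix (P.policy A n j))⁻¹.mulVec (P.a k)) := by
        rw [Finset.sum_comm, Finset.mul_sum]
        refine Finset.sum_congr rfl fun k _ => ?_
        rw [Finset.mul_sum, Finset.mul_sum, Finset.mul_sum]
        exact Finset.sum_congr rfl fun j _ => by ring
    _ ≤ 1 / N ^ 2 * ∑ _j : Fin N, (48 * (d : ℝ)) := by
        refine mul_le_mul_of_nonneg_left (Finset.sum_le_sum fun j _ => ?_) (by positivity)
        have hpos := policy_pos hP hd hK hT A n j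
        rw [← sum_mul_dotProduct_inv_self hP hpos, Finset.mul_sum]
        refine Finset.sum_le_sum fun k _ => ?_
        rw [← mul_assoc]
        refine mul_le_mul_of_nonneg_right ?_ (dotProduct_inv_self_nonneg hP hpos _)
        linarith [base_le_mul_policy hP hd hK hT A n i k,
          policy_le_mul_policy hP hd hK hT hB A htn i j k]
    _ = 48 * d / N := by
        rw [Finset.sum_const, Finset.card_univ, Fintype.card_fin, nsmul_eq_mul]
        field_simp

/-- Mean and error are separated by `(m + D)² ≤ 2m² + 2D²`. The mean is at most the number of rounds
of the block, so its square costs an extra factor `B`, but no `d`. -/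
theorem expect_base_mul_blockEst_sq_le (hP : P.Admissible) (hd : 0 < d) (hK : 2 ≤ K)
    (hT : 3 ≤ T) (hB : P.blockLen < T) (i : Fin N) (n : ℕ) :
    P.expect (fun A => ∑ k, P.base A n i k * P.blockEst A n k ^ 2) ≤
      (P.block n).card * (2 * P.blockLen + 96 * d / N) := by
  have h1 : ∀ A, ∑ k, P.base A n i k * P.blockEst A n k ^ 2 ≤
      2 * ((P.block n).card * P.blockLen) +
        2 * ∑ k, P.base A n i k * (∑ t ∈ P.block n, P.roundErr A t k) ^ 2 := by
    intro A
    have hb := base_mem (P := P) hK A n i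
    calc _ ≤ ∑ k, (P.base A n i k * (2 * ((P.block n).card * P.blockLen)) +
          2 * (P.base A n i k * (∑ t ∈ P.block n, P.roundErr A t k) ^ 2)) := by
          refine Finset.sum_le_sum fun k _ => ?_
          have h2 : P.blockEst A n k =
              ∑ t ∈ P.block n, P.avgLoss t k + ∑ t ∈ P.block n, P.roundErr A t k := by
            rw [← Finset.sum_add_distrib, blockEst]
            exact Finset.sum_congr rfl fun t _ => by rw [roundErr]; ring
          set m := ∑ t ∈ P.block n, P.avgLoss t k
          set D := ∑ t ∈ P.block n, P.roundErr A t k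
          have h3 : |m| ≤ (P.block n).card := by
            refine (Finset.abs_sum_le_sum_abs _ _).trans ?_
            refine (Finset.sum_le_card_nsmul _ _ 1 fun t _ => abs_avgLoss_le hP t k).trans ?_
            simp
          have h4 : ((P.block n).card : ℝ) ≤ P.blockLen := by
            exact_mod_cast card_block_le hP hK hT n
          have h5 : m ^ 2 ≤ (P.block n).card * P.blockLen := by
            rw [← sq_abs, sq]
            exact mul_le_mul h3 (h3.trans h4) (abs_nonneg _) (by positivity)
          have h6 : P.blockEst A n k ^ 2 ≤ 2 * ((P.block n).card * P.blockLen) + 2 * D ^ 2 := by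
            rw [h2]
            nlinarith [sq_nonneg (m - D)]
          nlinarith [mul_le_mul_of_nonneg_left h6 (hb.1 k)]
      _ = _ := by
          rw [Finset.sum_add_distrib, ← Finset.sum_mul, ← Finset.mul_sum, hb.2, one_mul]
  refine (expect_mono hP hd (by omega) hT h1).trans ?_
  rw [expect_add, expect_const hP hd (by omega) hT, expect_const_mul]
  have h2 := expect_base_mul_sq_sum_roundErr_le hP hd hK hT hB i n
  calc _ ≤ 2 * ((P.block n).card * (P.blockLen : ℝ)) + 2 * ((P.block n).card * (48 * d / N)) := by
        linarith
    _ = _ := by ring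

/-! ### The regret -/

/-- As `t / B ≤ t < T`, indices below `T` reach every block; the surplus ones are empty. -/
theorem sum_block {M : Type*} [AddCommMonoid M] (f : Fin T → M) :
    ∑ n ∈ Finset.range T, ∑ t ∈ P.block n, f t = ∑ t, f t :=
  Finset.sum_fiberwise_of_maps_to (fun t _ => Finset.mem_range.2
    ((Nat.div_le_self _ _).trans_lt t.2)) f

/-- The regret of agent `i` is bounded by the expected regret of its base learners on the network
averages of the estimates and by the cost of exploration. -/
theorem expect_avgLoss_sub_le (hP : P.Admissible) (hd : 0 < d) (hK : 2 ≤ K) (hT : 3 ≤ T)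
    (i : Fin N) (k₀ : Fin K) :
    P.expect (fun A => ∑ t, P.avgLoss t (A t i)) - ∑ t, P.avgLoss t k₀ ≤
      P.expect (fun A => ∑ n ∈ Finset.range T,
        (∑ k, P.base A n i k * P.blockEst A n k - P.blockEst A n k₀))
      + T * (2 * (P.alpha + P.beta)) := by
  have h1 : ∀ t : Fin T, P.expect (fun A => P.avgLoss t (A t i)) ≤
      P.expect (fun A => ∑ k, P.base A ((t : ℕ) / P.blockLen) i k * P.avgLoss t k)
        + 2 * (P.alpha + P.beta) := by
    intro t
    rw [expect_apply hP hd (by omega) hT t (fun _ x => P.avgLoss t (x i)) (fun _ _ _ => rfl),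
      ← expect_const hP hd (by omega) hT (2 * (P.alpha + P.beta)), ← expect_add]
    refine expect_mono hP hd (by omega) hT fun A => ?_
    rw [sum_pi_mul_apply (fun i => (policy_mem hP hd (by omega) hT A _ i).2)]
    exact sum_policy_mul_avgLoss_le hP hd hK hT A _ i t
  have h2 : ∀ t : Fin T, P.expect (fun A =>
      ∑ k, P.base A ((t : ℕ) / P.blockLen) i k * P.avgLoss t k) - P.avgLoss t k₀ =
      P.expect (fun A => ∑ k, P.base A ((t : ℕ) / P.blockLen) i k * P.roundEst A t k
        - P.roundEst A t k₀) := by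
    intro t
    have hcongr : ∀ k A A', (∀ s, s < t → A s = A' s) →
        P.base A ((t : ℕ) / P.blockLen) i k = P.base A' ((t : ℕ) / P.blockLen) i k := by
      intro k A A' h
      rw [base_congr _ fun s hs => h s (lt_of_mem_block
        (Finset.mem_filter.2 ⟨Finset.mem_univ t, rfl⟩) hs)]
    have h3 : ∀ k, P.expect (fun A => P.base A ((t : ℕ) / P.blockLen) i k * P.roundEst A t k) =
        P.expect (fun A => P.base A ((t : ℕ) / P.blockLen) i k * P.avgLoss t k) := by
      intro k
      have := expect_mul_roundErr hP hd hK hT t k (hcongr k)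
      simp only [roundErr, mul_sub] at this
      rw [expect_sub] at this
      linarith
    have h4 : P.expect (fun A => P.roundEst A t k₀) = P.avgLoss t k₀ := by
      have := expect_mul_roundErr hP hd hK hT t k₀ (w := fun _ => 1) (fun _ _ _ => rfl)
      simp only [roundErr, one_mul] at this
      rw [expect_sub, expect_const hP hd (by omega) hT] at this
      linarith
    rw [expect_sub, h4, expect_sum, expect_sum]
    simp only [h3]
  have h5 : ∀ A, ∑ n ∈ Finset.range T,
      (∑ k, P.base A n i k * P.blockEst A n k - P.blockEst A n k₀) =
      ∑ t : Fin T, (∑ k, P.base A ((t : ℕ) / P.blockLen) i k * P.roundEst A t k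
        - P.roundEst A t k₀) := by
    intro A
    rw [← sum_block (P := P)]
    refine Finset.sum_congr rfl fun n _ => ?_
    simp only [blockEst, Finset.mul_sum]
    rw [Finset.sum_comm, ← Finset.sum_sub_distrib]
    refine Finset.sum_congr rfl fun t ht => ?_
    rw [(Finset.mem_filter.1 ht).2]
  simp only [h5]
  rw [expect_sum, expect_sum]
  simp only [← h2]
  rw [Finset.sum_sub_distrib]
  have h6 := Finset.sum_le_sum fun t (_ : t ∈ Finset.univ) => h1 t
  rw [Finset.sum_add_distrib, Finset.sum_const, Finset.card_univ, Fintype.card_fin,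
    nsmul_eq_mul] at h6
  linarith

/-- The regret of the base learners on the network averages of the estimates. -/
theorem sum_base_mul_blockEst_sub_le (hP : P.Admissible) (hd : 0 < d) (hK : 2 ≤ K) (hT : 3 ≤ T)
    (hB : P.blockLen < T) (A : Fin T → Fin N → Fin K) (i : Fin N) (k₀ : Fin K) :
    ∑ n ∈ Finset.range T, (∑ k, P.base A n i k * P.blockEst A n k - P.blockEst A n k₀) ≤
      2 * (Real.log K / P.eta) + 2 / P.eta
        + 4 * P.eta * ∑ n ∈ Finset.range T, ∑ k, P.base A n i k * P.blockEst A n k ^ 2 := by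
  have hη := eta_pos hP hd hK hT
  have hT' : (3 : ℝ) ≤ T := by exact_mod_cast hT
  set ε := 1 / (P.eta * T ^ 2) with hε
  have hε0 : 0 ≤ ε := by positivity
  have hZ : ∀ n k, |P.fed A n i k - P.blockEst A n k| ≤ ε := fun n k =>
    abs_fed_sub_blockEst_le hP hd hK hT hB A n i k
  have hb := fun n => base_mem (P := P) hK A n i
  have key := expWeights_regret_interleaved (by omega) hη (fun n => P.fed A n i)
    (fun n k => abs_eta_mul_fed_le hP hd hK hT hB A n i k) T k₀ (fun n => P.base A n i)
    (fun n => base_eq hP hd hK hT A n i)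
  have h1 : ∀ n, ∑ k, P.base A n i k * P.blockEst A n k - P.blockEst A n k₀ ≤
      (∑ k, P.base A n i k * P.fed A n i k - P.fed A n i k₀) + 2 * ε := by
    intro n
    have h2 : ∑ k, P.base A n i k * P.blockEst A n k ≤
        ∑ k, (P.base A n i k * P.fed A n i k + P.base A n i k * ε) := by
      refine Finset.sum_le_sum fun k _ => ?_
      nlinarith [mul_le_mul_of_nonneg_left (abs_le.1 (hZ n k)).1 ((hb n).1 k)]
    rw [Finset.sum_add_distrib, ← Finset.sum_mul, (hb n).2, one_mul] at h2
    linarith [(abs_le.1 (hZ n k₀)).2]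
  have h3 : ∀ n, ∑ k, P.base A n i k * P.fed A n i k ^ 2 ≤
      2 * ∑ k, P.base A n i k * P.blockEst A n k ^ 2 + 2 * ε ^ 2 := by
    intro n
    calc _ ≤ ∑ k, (2 * (P.base A n i k * P.blockEst A n k ^ 2) + P.base A n i k * (2 * ε ^ 2)) := by
          refine Finset.sum_le_sum fun k _ => ?_
          have h4 : (P.fed A n i k - P.blockEst A n k) ^ 2 ≤ ε ^ 2 :=
            sq_le_sq' (abs_le.1 (hZ n k)).1 (abs_le.1 (hZ n k)).2
          have h5 : P.fed A n i k ^ 2 ≤ 2 * P.blockEst A n k ^ 2 + 2 * ε ^ 2 := by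
            nlinarith [sq_nonneg (P.fed A n i k - 2 * P.blockEst A n k)]
          nlinarith [mul_le_mul_of_nonneg_left h5 ((hb n).1 k)]
      _ = _ := by
          rw [Finset.sum_add_distrib, ← Finset.sum_mul, ← Finset.mul_sum, (hb n).2, one_mul]
  have h6 := Finset.sum_le_sum fun n (_ : n ∈ Finset.range T) => h1 n
  have h7 := Finset.sum_le_sum fun n (_ : n ∈ Finset.range T) => h3 n
  rw [Finset.sum_add_distrib, Finset.sum_const, Finset.card_range, nsmul_eq_mul] at h6 h7
  rw [← Finset.mul_sum] at h7
  have h8 : (T : ℝ) * (2 * ε) ≤ 1 / P.eta := by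
    have e : (T : ℝ) * (2 * ε) = 1 / P.eta * (2 / T) := by rw [hε]; field_simp
    rw [e]
    refine mul_le_of_le_one_right (by positivity) ?_
    rw [div_le_one (by linarith)]
    linarith
  have h9 : 2 * P.eta * (T * (2 * ε ^ 2)) ≤ 1 / P.eta := by
    have e : 2 * P.eta * (T * (2 * ε ^ 2)) = 1 / P.eta * (4 / T ^ 3) := by
      rw [hε]; field_simp; ring
    rw [e]
    refine mul_le_of_le_one_right (by positivity) ?_
    rw [div_le_one (by positivity)]
    have : (3 : ℝ) ^ 3 ≤ T ^ 3 := by gcongr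
    linarith
  have h10 := mul_le_mul_of_nonneg_left h7 (by positivity : 0 ≤ 2 * P.eta)
  have e2 : 2 / P.eta = 1 / P.eta + 1 / P.eta := by ring
  rw [e2]
  linarith

theorem expect_avgLoss_sub_le_eta (hP : P.Admissible) (hd : 0 < d) (hK : 2 ≤ K) (hT : 3 ≤ T)
    (hB : P.blockLen < T) (i : Fin N) (k₀ : Fin K) :
    P.expect (fun A => ∑ t, P.avgLoss t (A t i)) - ∑ t, P.avgLoss t k₀ ≤
      2 + 5 * (Real.log K / P.eta)
        + 384 * (P.eta * (d * T * P.blockLen + d * T / N)) := by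
  have hη := eta_pos hP hd hK hT
  have hN : (0 : ℝ) < N := by exact_mod_cast hP.pos_agents
  have hT' : (3 : ℝ) ≤ T := by exact_mod_cast hT
  have hd' : (1 : ℝ) ≤ d := by exact_mod_cast hd
  have h1 := expect_mono hP hd (by omega) hT
    fun A => sum_base_mul_blockEst_sub_le hP hd hK hT hB A i k₀
  rw [expect_add, expect_const hP hd (by omega) hT, expect_const_mul,
    expect_sum (Finset.range T) (fun n A => ∑ k, P.base A n i k * P.blockEst A n k ^ 2)] at h1
  have h2 := Finset.sum_le_sum fun n (_ : n ∈ Finset.range T) =>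
    expect_base_mul_blockEst_sq_le hP hd hK hT hB i n
  have h3 : ∑ n ∈ Finset.range T, ((P.block n).card : ℝ) = T := by
    have := sum_block (P := P) (fun _ : Fin T => (1 : ℝ))
    simpa using this
  rw [← Finset.sum_mul, h3] at h2
  have h4 := mul_le_mul_of_nonneg_left h2 (by positivity : 0 ≤ 4 * P.eta)
  have h5 := expect_avgLoss_sub_le hP hd hK hT i k₀
  have h6 : (T : ℝ) * (2 * (P.alpha + P.beta)) = 2 + 6 * (P.eta * (d * T * P.blockLen)) := by
    unfold alpha beta
    field_simp
    ring
  have h7 : 4 * P.eta * (T * (2 * P.blockLen + 96 * d / N)) ≤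
      8 * (P.eta * (d * T * P.blockLen)) + 384 * (P.eta * (d * T / N)) := by
    have e : 4 * P.eta * (T * (2 * P.blockLen + 96 * d / N)) =
      8 * (P.eta * (T * P.blockLen)) + 384 * (P.eta * (d * T / N)) := by ring
    rw [e]
    have : (T : ℝ) * P.blockLen ≤ d * T * P.blockLen := by
      rw [mul_assoc]
      exact le_mul_of_one_le_left (by positivity) hd'
    gcongr
  -- `K ≥ 2` and `log 2 > 2/3` absorb the gossip error into the entropy term.
  have h8 : 2 / P.eta ≤ 3 * (Real.log K / P.eta) := by
    have h9 : Real.log 2 ≤ Real.log K :=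
      Real.log_le_log (by norm_num) (by exact_mod_cast hK)
    rw [← mul_div_assoc]
    gcongr
    linarith [Real.log_two_gt_d9]
  have h10 : 0 ≤ P.eta * (d * T * P.blockLen) := by positivity
  rw [mul_add P.eta]
  linarith

theorem maxRegret_le_of_forall (hP : P.Admissible) (hd : 0 < d) (hK : 2 ≤ K) (hT : 3 ≤ T) {R : ℝ}
    (h : ∀ i k₀, P.expect (fun A => ∑ t, P.avgLoss t (A t i)) - ∑ t, P.avgLoss t k₀ ≤ R) :
    P.maxRegret ≤ R := by
  have : Nonempty (Fin N) := ⟨⟨0, hP.pos_agents⟩⟩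
  have : Nonempty (Fin K) := ⟨⟨0, by omega⟩⟩
  refine ciSup_le fun i => ?_
  obtain ⟨k₀, hk₀⟩ := exists_eq_ciInf_of_finite (f := fun k => P.expect (fun _ => ∑ t, P.avgLoss t k))
  rw [regret, ← hk₀, expect_const hP hd (by omega) hT]
  exact h i k₀

theorem maxRegret_le (hP : P.Admissible) (hd : 0 < d) (hK : 2 ≤ K) (hT : 3 ≤ T) :
    P.maxRegret ≤ 389 * (√(Real.log K * ((P.blockLen : ℝ) + 1 / N) * d * T)
      + d * P.blockLen * Real.log K) := by
  have hN : (0 : ℝ) < N := by exact_mod_cast hP.pos_agents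
  have hT' : (3 : ℝ) ≤ T := by exact_mod_cast hT
  have hd' : (1 : ℝ) ≤ d := by exact_mod_cast hd
  have hB' : (1 : ℝ) ≤ P.blockLen := by exact_mod_cast blockLen_pos hP hK hT
  have hlog : 1 / 2 ≤ Real.log K := by
    have h9 : Real.log 2 ≤ Real.log K :=
      Real.log_le_log (by norm_num) (by exact_mod_cast hK)
    linarith [Real.log_two_gt_d9]
  have hη := eta_pos hP hd hK hT
  have hdB : (P.blockLen : ℝ) ≤ d * P.blockLen := le_mul_of_one_le_left (by positivity) hd'
  have hdBlog : (P.blockLen : ℝ) ≤ 2 * (d * P.blockLen * Real.log K) := by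
    nlinarith
  refine maxRegret_le_of_forall hP hd hK hT fun i k₀ => ?_
  rcases lt_or_ge P.blockLen T with hB | hB
  · have h1 := expect_avgLoss_sub_le_eta hP hd hK hT hB i k₀
    set Q := (d * T * P.blockLen + d * T / N : ℝ) with hQ
    have hQ0 : 0 < Q := by positivity
    have e1 : Real.log K * ((P.blockLen : ℝ) + 1 / N) * d * T = Real.log K * Q := by
      rw [hQ]; ring
    rw [e1]
    have hηdef : P.eta = min (1 / (6 * (P.blockLen : ℝ) * d)) (√(Real.log K / Q)) := rfl
    have h2 : P.eta * Q ≤ √(Real.log K * Q) := by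
      calc P.eta * Q ≤ √(Real.log K / Q) * Q := by
            rw [hηdef]; gcongr; exact min_le_right _ _
        _ = √(Real.log K * Q) := by
            have e2 : Real.log K * Q = Real.log K / Q * Q ^ 2 := by field_simp
            rw [e2, Real.sqrt_mul (by positivity), Real.sqrt_sq hQ0.le]
    -- The two candidates in the minimum defining `η` produce the two terms; the constant 389 is
    -- `384 + 5`.
    have h3 : Real.log K / P.eta ≤ √(Real.log K * Q) + 6 * (d * P.blockLen * Real.log K) := by
      rcases min_choice (1 / (6 * (P.blockLen : ℝ) * d)) (√(Real.log K / Q)) with h4 | h4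
      · rw [hηdef, h4]
        have e3 : Real.log K / (1 / (6 * P.blockLen * d)) = 6 * (d * P.blockLen * Real.log K) := by
          field_simp
        rw [e3]
        linarith [Real.sqrt_nonneg (Real.log K * Q)]
      · rw [hηdef, h4]
        have e3 : Real.log K / √(Real.log K / Q) = √(Real.log K * Q) := by
          rw [div_eq_iff (by positivity), ← Real.sqrt_mul (by positivity)]
          have e4 : Real.log K * Q * (Real.log K / Q) = Real.log K ^ 2 := by field_simp
          rw [e4, Real.sqrt_sq (by linarith)]
        rw [e3]
        have : 0 ≤ d * P.blockLen * Real.log K := by positivity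
        linarith
    linarith
  -- With `B ≥ T` no gossip bound is available, but the regret is at most `2T ≤ 2B`, which the term
  -- `d B log K` covers.
  · have h1 : P.expect (fun A => ∑ t, P.avgLoss t (A t i)) ≤ T := by
      rw [← expect_const hP hd (by omega) hT (T : ℝ)]
      refine expect_mono hP hd (by omega) hT fun A => ?_
      refine (Finset.sum_le_card_nsmul _ _ 1 fun t _ =>
        (abs_le.1 (abs_avgLoss_le hP t _)).2).trans ?_
      simp
    have h2 : -(T : ℝ) ≤ ∑ t, P.avgLoss t k₀ := by
      have := Finset.card_nsmul_le_sum Finset.univ (fun t => P.avgLoss t k₀) (-1) fun t _ =>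
        (abs_le.1 (abs_avgLoss_le hP t k₀)).1
      simpa using this
    have h3 : (T : ℝ) ≤ P.blockLen := by exact_mod_cast hB
    have h4 := Real.sqrt_nonneg (Real.log K * ((P.blockLen : ℝ) + 1 / N) * d * T)
    linarith

/-- The block length in terms of the spectral gap. -/
theorem blockLen_le (hP : P.Admissible) (hK : 2 ≤ K) (hT : 3 ≤ T) :
    (P.blockLen : ℝ) ≤ 31 * Real.log ((K : ℝ) * N * T) * P.gap ^ (-(1 / 2) : ℝ) := by
  have hN : (1 : ℝ) ≤ N := by exact_mod_cast hP.pos_agents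
  have hK' : (2 : ℝ) ≤ K := by exact_mod_cast hK
  have hT' : (3 : ℝ) ≤ T := by exact_mod_cast hT
  have hgap0 : 0 < P.gap := sub_pos.2 hP.sigma2_lt_one
  have hgap1 : P.gap ≤ 1 := by
    unfold gap; linarith [sigma2_nonneg P.W]
  have hrpow : P.gap ^ (-(1 / 2) : ℝ) = 1 / √P.gap := by
    rw [Real.rpow_neg hgap0.le, ← Real.sqrt_eq_rpow, one_div]
  have hs0 : 0 < √P.gap := Real.sqrt_pos.2 hgap0
  have hs1 : √P.gap ≤ 1 := Real.sqrt_le_one.2 hgap1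
  set Λ := Real.log ((K : ℝ) * N * T) with hΛ
  have h6 : (6 : ℝ) ≤ (K : ℝ) * N * T := by
    have : 2 * 1 * 3 ≤ (K : ℝ) * N * T := by gcongr
    linarith
  have hΛ1 : 1 ≤ Λ := by
    rw [hΛ, Real.le_log_iff_exp_le (by positivity)]
    linarith [Real.exp_one_lt_d9]
  set Q := ((K : ℝ) * T) ^ 6 * √(14 * N) with hQ
  have hlogQ : Real.log Q ≤ 8 * Λ := by
    have h1 : Q ≤ ((K : ℝ) * N * T) ^ 8 := by
      have h2 : √(14 * (N : ℝ)) ≤ (K * N * T) ^ 2 := by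
        refine Real.sqrt_le_iff.2 ⟨by positivity, ?_⟩
        have h3 : (N : ℝ) ≤ K * N * T := by
          rw [mul_right_comm]
          exact le_mul_of_one_le_left (by positivity) (by nlinarith)
        have h4 : (6 : ℝ) ^ 3 ≤ ((K : ℝ) * N * T) ^ 3 := by gcongr
        calc 14 * (N : ℝ) ≤ 6 ^ 3 * N := by nlinarith
          _ ≤ (K * N * T) ^ 3 * (K * N * T) := by gcongr
          _ = _ := by ring
      calc Q ≤ ((K : ℝ) * N * T) ^ 6 * (K * N * T) ^ 2 := by
            rw [hQ]
            gcongr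
            nlinarith
        _ = _ := by ring
    calc Real.log Q ≤ Real.log (((K : ℝ) * N * T) ^ 8) := Real.log_le_log (by positivity) h1
      _ = _ := by rw [Real.log_pow]; norm_num [hΛ]
  have hlogQ0 := log_blockLen_pos hP hK hT
  have hc : (0.28 : ℝ) ≤ 1 - 1 / √2 := by
    have h2 : (1.39 : ℝ) ≤ √2 := Real.le_sqrt_of_sq_le (by norm_num)
    have h3 : 1 / √2 ≤ 1 / 1.39 := one_div_le_one_div_of_le (by norm_num) h2
    norm_num at h3 ⊢
    linarith
  have hdef : P.blockLen = ⌈Real.log Q / ((1 - 1 / √2) * √P.gap)⌉₊ := rfl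
  have h1 : (P.blockLen : ℝ) ≤ Real.log Q / ((1 - 1 / √2) * √P.gap) + 1 := by
    rw [hdef]
    refine (Nat.ceil_lt_add_one ?_).le
    exact div_nonneg hlogQ0.le (mul_nonneg (by linarith) hs0.le)
  have h2 : Real.log Q / ((1 - 1 / √2) * √P.gap) ≤ 8 * Λ / (0.28 * √P.gap) := by
    gcongr
  have h3 : 1 ≤ Λ / √P.gap := by
    rw [le_div_iff₀ hs0]; linarith
  rw [hrpow]
  have e : 8 * Λ / (0.28 * √P.gap) = 8 / 0.28 * (Λ / √P.gap) := by ring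
  have e2 : 31 * Λ * (1 / √P.gap) = 31 * (Λ / √P.gap) := by ring
  rw [e] at h2
  rw [e2]
  -- Rounding up in the block length accounts for the step from 30 to 31.
  have h4 : 8 / 0.28 * (Λ / √P.gap) ≤ 30 * (Λ / √P.gap) := by
    refine mul_le_mul_of_nonneg_right (by norm_num) (by linarith)
  linarith

/-- Of the two logarithms one comes from `B` and one from `log K`. Only the term `d B log K` needs
the full square; under the root a single power would do. -/
theorem maxRegret_le_gap (hP : P.Admissible) (hd : 0 < d) (hK : 2 ≤ K) (hT : 3 ≤ T) :
    P.maxRegret ≤ (389 * 31) * Real.log ((K : ℝ) * N * T) ^ 2 *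
      (√((P.gap ^ (-(1 / 2) : ℝ) + 1 / N) * d * T) + d * P.gap ^ (-(1 / 2) : ℝ)) := by
  have hN : (1 : ℝ) ≤ N := by exact_mod_cast hP.pos_agents
  have hK' : (2 : ℝ) ≤ K := by exact_mod_cast hK
  have hT' : (3 : ℝ) ≤ T := by exact_mod_cast hT
  have hgap0 : 0 < P.gap := sub_pos.2 hP.sigma2_lt_one
  have hB := blockLen_le hP hK hT
  set g := P.gap ^ (-(1 / 2) : ℝ) with hg
  have hg0 : 0 < g := Real.rpow_pos_of_pos hgap0 _
  set Λ := Real.log ((K : ℝ) * N * T) with hΛ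
  have hNT : 1 ≤ (N : ℝ) * T := by nlinarith
  have hlog : Real.log K ≤ Λ := by
    refine Real.log_le_log (by positivity) ?_
    rw [mul_assoc]
    exact le_mul_of_one_le_right (by positivity) hNT
  have hlog0 : 0 ≤ Real.log K := Real.log_nonneg (by linarith)
  have hΛ1 : 1 ≤ Λ := by
    have h6 : 2 * 1 * 3 ≤ (K : ℝ) * N * T := by gcongr
    rw [hΛ, Real.le_log_iff_exp_le (by positivity)]
    linarith [Real.exp_one_lt_d9]
  have h1 : √(Real.log K * ((P.blockLen : ℝ) + 1 / N) * d * T) ≤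
      31 * Λ ^ 2 * √((g + 1 / N) * d * T) := by
    rw [← Real.sqrt_sq (by positivity : 0 ≤ 31 * Λ ^ 2), ← Real.sqrt_mul (by positivity)]
    refine Real.sqrt_le_sqrt ?_
    have h2 : (P.blockLen : ℝ) + 1 / N ≤ 31 * Λ * (g + 1 / N) := by
      have h3 : 1 / (N : ℝ) ≤ 31 * Λ * (1 / N) :=
        le_mul_of_one_le_left (by positivity) (by linarith)
      rw [mul_add]
      linarith
    have h4 : Λ * (31 * Λ) ≤ (31 * Λ ^ 2) ^ 2 := by nlinarith [one_le_pow₀ hΛ1 (n := 2)]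
    calc _ ≤ Λ * (31 * Λ * (g + 1 / N)) * d * T := by gcongr
      _ = Λ * (31 * Λ) * ((g + 1 / N) * d * T) := by ring
      _ ≤ _ := by gcongr
  have h2 : d * P.blockLen * Real.log K ≤ 31 * Λ ^ 2 * (d * g) := by
    calc d * P.blockLen * Real.log K ≤ d * (31 * Λ * g) * Λ := by gcongr
      _ = _ := by ring
  calc _ ≤ _ := maxRegret_le hP hd hK hT
    _ ≤ 389 * (31 * Λ ^ 2 * √((g + 1 / N) * d * T) + 31 * Λ ^ 2 * (d * g)) := by gcongr
    _ = _ := by ring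

theorem commCost_le (hP : P.Admissible) (A : Fin T → Fin N → Fin K) (t : Fin T) (i : Fin N) :
    P.commCost A t i ≤ 3 * d := by
  simpa [commCost, message] using hP.card_le

end Setting

end DistLinBandit

end

theorem mainTheorem5 :
    (∃ C : ℝ, 0 < C ∧ ∀ N K d T : ℕ, 1 ≤ d → 2 ≤ K → 3 ≤ T →
      ∀ P : DistLinBandit.Setting N K d T, P.Admissible →
        P.maxRegret ≤
          C * (√(Real.log K * ((P.blockLen : ℝ) + 1 / N) * d * T)
            + d * P.blockLen * Real.log K)) ∧
    (∃ C : ℝ, 0 < C ∧ ∃ r : ℕ, ∀ N K d T : ℕ, 1 ≤ d → 2 ≤ K → 3 ≤ T →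
      ∀ P : DistLinBandit.Setting N K d T, P.Admissible →
        P.maxRegret ≤
          C * Real.log ((K : ℝ) * N * T) ^ r *
            (√((P.gap ^ (-(1 / 2) : ℝ) + 1 / N) * d * T) + d * P.gap ^ (-(1 / 2) : ℝ))) ∧
    (∀ N K d T : ℕ, 1 ≤ d → 2 ≤ K → 3 ≤ T →
      ∀ P : DistLinBandit.Setting N K d T, P.Admissible →
        ∀ (A : Fin T → Fin N → Fin K) (t : Fin T) (i : Fin N), P.commCost A t i ≤ 3 * d) :=
  ⟨⟨389, by norm_num, fun _ _ _ _ hd hK hT _ hP =>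
      DistLinBandit.Setting.maxRegret_le hP hd hK hT⟩,
    ⟨389 * 31, by norm_num, 2, fun _ _ _ _ hd hK hT _ hP =>
      DistLinBandit.Setting.maxRegret_le_gap hP hd hK hT⟩,
    fun _ _ _ _ _ _ _ _ hP A t i => DistLinBandit.Setting.commCost_le hP A t i⟩
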